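/- Let $\mathcal X$ and $\bar{\mathcal X}$ be rational surfaces over $\mathbb C$, each obtained from $\mathbb P^1\times\mathbb P^1$ by a finite (possibly empty) sequence of blowups of points, possibly infinitely near, with blowdown maps $\pi:\mathcal X\to\mathbb P^1\times\mathbb P^1$ and $\bar\pi:\bar{\mathcal X}\to\mathbb P^1\times\mathbb P^1$. Let $\varphi:\mathbb P^1\times\mathbb P^1\dashrightarrow\mathbb P^1\times\mathbb P^1$, $\varphi(x,y)=(\bar x,\bar y)$, be a dominant rational map, and let $\tilde\varphi:\mathcal X\dashrightarrow\bar{\mathcal X}$ be its extension, so that $\bar\pi\circ\tilde\varphi=\varphi\circ\pi$ as rational maps; thus $\bar x,\bar y\in\mathbb C(x,y)$. Pull-backs of divisors under dominant rational maps of these smooth surfaces are formed by pulling back local equations at the generic points of prime divisors. Let $\bar x_1\ne\bar x_2$ and $\bar y_1\neq\bar y_2$ be points of $\mathbb P^1=\mathbb C\cup\{\infty\}$, and consider the prime divisors $\bar D_1=V(\bar x-\bar x_1)$, $\bar D_2=V(\bar x-\bar x_2)$, $\bar D_3=V(\bar y-\bar y_1)$, $\bar D_4=V(\bar y-\bar y_2)$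 on the target $\mathbb P^1\times\mathbb P^1$. Let $$\bar\pi^*(\bar D_i)=\sum_{j=1}^{J_i}n_{i,j}\bar D_{i,j},\qquad \tilde\varphi^*(\bar D_{i,j})=\sum_{k=1}^{K_{i,j}}m_{i,j,k}D'_{i,j,k}$$ be the expressions of the pull-backs in terms of distinct prime divisors. Let $D_{i,j,k}=\pi_*(D'_{i,j,k})$ (which is $0$ if $\pi$ contracts $D'_{i,j,k}$ to a point), and let $p_{i,j,k}(x,y)\in\mathbb C[x,y]$ be an irreducible defining polynomial of $D_{i,j,k}$ in the affine chart $(x,y)$, where $p_{i,j,k}=1$ if $D_{i,j,k}=0$ or if $D_{i,j,k}$ is one of the lines $x=\infty$, $y=\infty$. For $a\in\mathbb P^1$ put $l_a(t)=t-a$ if $a\neq\infty$, and $l_a(t)=1$ if $a=\infty$. Then there are nonzero constants $C_1,C_2\in\mathbb C$ such that, in $\mathbb C(x,y)$, $$\frac{l_{\bar x_1}(\bar x)}{l_{\bar x_2}(\bar x)}=C_1\,\frac{\prod_{j=1}^{J_1}\Bigl(\prod_{k=1}^{K_{1,j}}p_{1,j,k}(x,y)^{m_{1,j,k}}\Bigr)^{n_{1,j}}}{\prod_{j=1}^{J_2}\Bigl(\prod_{k=1}^{K_{2,j}}p_{2,j,k}(x,y)^{m_{2,j,k}}\Bigr)^{n_{2,j}}},\qquad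 \frac{l_{\bar y_1}(\bar y)}{l_{\bar y_2}(\bar y)}=C_2\,\frac{\prod_{j=1}^{J_3}\Bigl(\prod_{k=1}^{K_{3,j}}p_{3,j,k}(x,y)^{m_{3,j,k}}\Bigr)^{n_{3,j}}}{\prod_{j=1}^{J_4}\Bigl(\prod_{k=1}^{K_{4,j}}p_{4,j,k}(x,y)^{m_{4,j,k}}\Bigr)^{n_{4,j}}}.$$ -/

import Mathlib

open scoped OnePoint

noncomputable section

namespace BlowupFactorization

/-!
Surfaces birational to `ℙ¹ × ℙ¹` over `ℂ` are handled in the classical language of models: such a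
surface is the collection of the local rings of all its scheme points (the generic point, the
generic points of the irreducible curves, and the closed points), viewed as subrings of the common
function field `ℂ(x, y)`.

* A point `q` lies on the closure of a point `z` iff the local ring of `q` is contained in the
  local ring of `z`.
* A birational morphism `Y → X` identifying the function fields sends a point of `Y` to the unique
  point of `X` whose local ring is dominated by that of the given point.
* A dominant rational map `X ⇢ Y` is the same thing as a homomorphism of `ℂ`-algebras
  `ℂ(Y) → ℂ(X)` (its comorphism).
-/

/-- The field `ℂ(x, y)` of rational functions on `ℙ¹ × ℙ¹`. -/
abbrev RatFun : Type := FractionRing (MvPolynomial (Fin 2) ℂ)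

/-- A polynomial in `x` and `y`, viewed as a rational function. -/
def polyFun (p : MvPolynomial (Fin 2) ℂ) : RatFun := algebraMap (MvPolynomial (Fin 2) ℂ) RatFun p

/-- The affine coordinate `x` on the first factor. -/
def xFun : RatFun := polyFun (MvPolynomial.X 0)

/-- The affine coordinate `y` on the second factor. -/
def yFun : RatFun := polyFun (MvPolynomial.X 1)

/-- A collection of points, each of them given by its local ring inside `ℂ(x, y)`. -/
abbrev Model : Type := Set (LocalSubring RatFun)

/-- The maximal ideal of a local ring, i.e. the functions that vanish at the point. -/
def vanishingSet (R : LocalSubring RatFun) : Set RatFun :=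
  {a | ∃ h : a ∈ R.toSubring, (⟨a, h⟩ : R.toSubring) ∈ IsLocalRing.maximalIdeal R.toSubring}

/-- The affine variety `Spec A`: all localizations of `A` at its prime ideals. -/
def affineModel (A : Subring RatFun) : Model :=
  {R | ∃ (P : Ideal A) (_ : P.IsPrime), R = LocalSubring.ofPrime A P}

/-- The surface `ℙ¹ × ℙ¹`, the union of the four charts with affine coordinates
`(x, y)`, `(1/x, y)`, `(x, 1/y)` and `(1/x, 1/y)`. -/
def P1P1 : Model :=
  {R | ∃ u ∈ ({xFun, xFun⁻¹} : Set RatFun), ∃ v ∈ ({yFun, yFun⁻¹} : Set RatFun),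
    R ∈ affineModel (Algebra.adjoin ℂ {u, v}).toSubring}

/-- `R` is the local ring of a closed point: every element of `R` has a value in `ℂ`, that is,
the residue field is `ℂ`. -/
def IsClosedPoint (R : LocalSubring RatFun) : Prop :=
  ∀ a ∈ R.toSubring, ∃ c : ℂ, a - algebraMap ℂ RatFun c ∈ vanishingSet R

/-- The coordinate ring `R[𝔪/t]` of the chart of the blowup of `Spec R` at its closed point in
which the exceptional curve has the equation `t = 0`; here `𝔪` is the maximal ideal of `R`. -/
def blowupChart (R : LocalSubring RatFun) (t : RatFun) : Subring RatFun :=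
  Subring.closure ((R.toSubring : Set RatFun) ∪ {b | ∃ a ∈ vanishingSet R, b = a / t})

/-- The blowup of the surface `X` at the point `p`: the point `p` is removed, and the points of
the charts `Spec 𝒪_p[𝔪_p/t]`, `0 ≠ t ∈ 𝔪_p`, that lie over `p` are put in its place. -/
def blowup (X : Model) (p : LocalSubring RatFun) : Model :=
  (X \ {p}) ∪
    {S | ∃ t ∈ vanishingSet p, t ≠ 0 ∧ S ∈ affineModel (blowupChart p t) ∧ p ≤ S}

/-- The surfaces obtained from `ℙ¹ × ℙ¹` by a finite (possibly empty) sequence of blowups of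
closed points, each of them possibly infinitely near to the previous ones. The blowdown map to
`ℙ¹ × ℙ¹` is the one that induces the identity on `ℂ(x, y)`. -/
inductive IsBlownUpSurface : Model → Prop
  | base : IsBlownUpSurface P1P1
  | step (X : Model) (p : LocalSubring RatFun) (hX : IsBlownUpSurface X) (hp : p ∈ X)
      (hclosed : IsClosedPoint p) : IsBlownUpSurface (blowup X p)

/-- The prime divisors (irreducible curves) of a regular surface, given by their generic points:
the points of codimension one, i.e. those whose local ring is a discrete valuation ring. -/
abbrev PrimeDivisor (X : Model) : Type :=
  {R : LocalSubring RatFun // R ∈ X ∧ IsDiscreteValuationRing R.toSubring}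

/-- Weil divisors: finite formal integral combinations of distinct prime divisors. -/
abbrev WeilDiv (X : Model) : Type := PrimeDivisor X →₀ ℤ

/-- The nonzero rational function `f` has order `n` along the prime divisor with local ring `R`:
it is a unit of `R` times the `n`-th power of a uniformizer. -/
def HasOrder (R : LocalSubring RatFun) (f : RatFun) (n : ℤ) : Prop :=
  ∃ (ϖ : R.toSubring) (u : (R.toSubring)ˣ), Irreducible ϖ ∧
    f = ((u : R.toSubring) : RatFun) * (ϖ : RatFun) ^ n

/-- `g` is a local equation of the divisor `D` at the point `q`: the orders of `g` along all prime
divisors that pass through `q` are the coefficients of `D`. -/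
def IsLocalEquation {X : Model} (D : WeilDiv X) (q : LocalSubring RatFun) (g : RatFun) : Prop :=
  g ≠ 0 ∧ ∀ Z : PrimeDivisor X, q.toSubring ≤ Z.1.toSubring → HasOrder Z.1 g (D Z)

/-- The dominant rational map with comorphism `φ` is defined at the point with local ring `R` and
sends it to the point with local ring `q`: `φ(q) ⊆ R`, and this is a local homomorphism. -/
def MapsTo (φ : RatFun →ₐ[ℂ] RatFun) (R q : LocalSubring RatFun) : Prop :=
  q.map (φ : RatFun →+* RatFun) ≤ R

/-- `E` is the pull-back `φ^*(D)` of the divisor `D` on `Y` under the dominant rational map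
`X ⇢ Y` with comorphism `φ`: the coefficient of `E` at a prime divisor `R` is the order along `R`
of the composition with the map of a local equation of `D` at the image of (the generic point
of) `R`. -/
def IsPullback (φ : RatFun →ₐ[ℂ] RatFun) {X Y : Model} (D : WeilDiv Y) (E : WeilDiv X) : Prop :=
  ∀ R : PrimeDivisor X, ∃ q ∈ Y, MapsTo φ R.1 q ∧
    ∃ g : RatFun, IsLocalEquation D q g ∧ HasOrder R.1 (φ g) (E R)

open Classical in
/-- The push-forward of a prime divisor `W` of `X` under the birational morphism `X → Y` inducing
the identity on `ℂ(x, y)`: the image of `W` if it is a curve (the degree of `W` over its image is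
then one, the morphism being birational), and `0` if `W` is contracted to a point. -/
def pushforwardPrime {X : Model} (Y : Model) (W : PrimeDivisor X) : WeilDiv Y :=
  if h : ∃ Z : PrimeDivisor Y, Z.1 ≤ W.1 then Finsupp.single h.choose 1 else 0

/-- The push-forward of Weil divisors under the birational morphism `X → Y`. -/
def pushforward {X : Model} (Y : Model) (D : WeilDiv X) : WeilDiv Y :=
  D.sum fun W n => n • pushforwardPrime Y W

/-- The value of a nonconstant function `c` along the prime divisor with local ring `R` is the
point `a` of `ℙ¹ = ℂ ∪ {∞}`. -/
def HasValue (R : LocalSubring RatFun) (c : RatFun) (a : OnePoint ℂ) : Prop :=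
  a.elim (c⁻¹ ∈ vanishingSet R) fun b => c - algebraMap ℂ RatFun b ∈ vanishingSet R

/-- `D` is the divisor `V(c - a)` on `ℙ¹ × ℙ¹`, where `c` is one of the coordinates `x`, `y` and
`a ∈ ℙ¹`: the unique irreducible curve along which `c` is equal to `a`. -/
def IsCoordinateLine (c : RatFun) (a : OnePoint ℂ) (D : WeilDiv P1P1) : Prop :=
  ∃ Z : PrimeDivisor P1P1, HasValue Z.1 c a ∧ D = Finsupp.single Z 1

/-- The affine linear form `l(c)` that defines the point `a` of `ℙ¹`: it is `c - a` for finite `a`,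
and `1` for `a = ∞`. -/
def linForm (a : OnePoint ℂ) (c : RatFun) : RatFun :=
  a.elim 1 fun b => c - algebraMap ℂ RatFun b

/-- `p` is an irreducible defining polynomial in the affine coordinates `x`, `y` of the divisor
`D` on `ℙ¹ × ℙ¹`, where `D` is zero or a prime divisor. If `D` is a curve that meets the affine
chart `(x, y)`, then `p` is irreducible and generates the ideal of the curve. If `D` is zero or one
of the lines `x = ∞`, `y = ∞`, which do not meet the chart, then `p = 1`. -/
def IsDefiningPolynomial (D : WeilDiv P1P1) (p : MvPolynomial (Fin 2) ℂ) : Prop :=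
  (D = 0 ∧ p = 1) ∨
  ∃ Z : PrimeDivisor P1P1, D = Finsupp.single Z 1 ∧
    (((xFun ∈ Z.1.toSubring ∧ yFun ∈ Z.1.toSubring) ∧ Irreducible p ∧
        ∀ a : MvPolynomial (Fin 2) ℂ, polyFun a ∈ vanishingSet Z.1 ↔ p ∣ a) ∨
      (¬ (xFun ∈ Z.1.toSubring ∧ yFun ∈ Z.1.toSubring) ∧ p = 1))

/-- The product `∏ⱼ (∏ₖ pⱼₖ ^ mⱼₖ) ^ nⱼ`, where `A = ∑ⱼ nⱼ Aⱼ` and `B Aⱼ = ∑ₖ mⱼₖ Bⱼₖ` are the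
expressions in terms of distinct prime divisors, and `pⱼₖ = p Aⱼ Bⱼₖ`. -/
def factorProduct {X Y : Model} (A : WeilDiv Y) (B : PrimeDivisor Y → WeilDiv X)
    (p : PrimeDivisor Y → PrimeDivisor X → MvPolynomial (Fin 2) ℂ) : RatFun :=
  A.prod fun Z n => ((B Z).prod fun W m => polyFun (p Z W) ^ m) ^ n

end BlowupFactorization

end

open BlowupFactorization

/-! The units of ℂ[x, y] are the nonzero constants, so two nonzero rational functions agree up to a
constant once they have the same order along every curve that meets the affine plane
(`exists_eq_algebraMap`). The proof computes these orders for both sides.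

For a target coordinate c, the divisor of l_a(c) on ℙ¹ × ℙ¹ is the line c = a minus the line c = ∞,
also when a = ∞. Hence F = l_{a₁}(c)/l_{a₂}(c) has divisor D₁ − D₂
(`IsCoordinateLine.hasOrder_div`). Pulling back first by the blowdown and then by the rational map
shows that the order of φ F along a curve is the signed sum of the numbers n·m belonging to that
curve (`hasOrder_of_isPullback_id`, `hasOrder_map_of_isPullback`). On the other side, a defining
polynomial has order 1 along its own curve and 0 along every other curve of the plane, while
contracted divisors and lines at infinity contribute the factor 1 (`hasOrder_factorProduct`).

The delicate point is pull-back: the generic point of a curve may be sent to a closed point q, and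
the orders along the curves through q must determine a function up to a unit of its local ring. They
do because that ring is factorial (`IsRegularModel.mem_of_hasOrder_zero`,
`IsRegularModel.hasOrder_map`). Factoriality comes from the elementary invariant `IsRegularPoint`:
the ring is noetherian and either a field or equipped with a prime element u modulo which ideals are
principal. Blowing up preserves it, since in a nontrivial chart the exceptional curve is an affine
line over the residue field (`IsRegularPoint.of_blowupChart`). -/

noncomputable section

namespace BlowupFactorization

/-! ### Domination and localization for local subrings of a field. -/

section Generalities

variable {K : Type*} [Field K]

theorem isUnit_subring_iff {A : Subring K} {a : A} :
    IsUnit a ↔ (a : K) ≠ 0 ∧ (a : K)⁻¹ ∈ A := by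
  constructor
  · intro h
    obtain ⟨b, hb⟩ := h.exists_right_inv
    have hb' : (a : K) * b = 1 := by exact_mod_cast congrArg Subtype.val hb
    have h0 : (a : K) ≠ 0 := left_ne_zero_of_mul_eq_one hb'
    exact ⟨h0, by rw [← eq_inv_of_mul_eq_one_right hb']; exact b.2⟩
  · rintro ⟨h0, h⟩
    exact IsUnit.of_mul_eq_one ⟨_, h⟩ (Subtype.ext (mul_inv_cancel₀ h0))

/-- Locality of the inclusion says that an element of R invertible in S is already invertible in R.
Phrased with inverses in K, it needs no maximal ideals; 0 is harmless because its inverse is 0. -/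
theorem localSubring_le_iff {R S : LocalSubring K} :
    R ≤ S ↔ R.toSubring ≤ S.toSubring ∧
      ∀ a ∈ R.toSubring, a⁻¹ ∈ S.toSubring → a⁻¹ ∈ R.toSubring := by
  rw [LocalSubring.le_def]
  constructor
  · rintro ⟨h, hl⟩
    refine ⟨h, fun a ha hi => ?_⟩
    by_cases h0 : a = 0
    · simp [h0]
    have := hl.map_nonunit ⟨a, ha⟩ (isUnit_subring_iff.2 ⟨h0, hi⟩)
    exact (isUnit_subring_iff.1 this).2
  · rintro ⟨h, hl⟩
    refine ⟨h, ⟨fun a ha => ?_⟩⟩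
    have := isUnit_subring_iff.1 ha
    exact isUnit_subring_iff.2 ⟨this.1, hl _ a.2 this.2⟩

/-- The local ring `V` is a localization of the subring `A` of the field `K`. -/
def IsLocAt (A : Subring K) (V : LocalSubring K) : Prop :=
  A ≤ V.toSubring ∧ ∀ f ∈ V.toSubring, ∃ a ∈ A, ∃ s ∈ A, s ≠ 0 ∧ s⁻¹ ∈ V.toSubring ∧ f = a * s⁻¹

theorem isLocAt_ofPrime (A : Subring K) (P : Ideal A) [P.IsPrime] :
    IsLocAt A (LocalSubring.ofPrime A P) := by
  refine ⟨LocalSubring.le_ofPrime A P, fun f hf => ?_⟩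
  obtain ⟨⟨a, s⟩, h⟩ := IsLocalization.surj P.primeCompl
    (⟨f, hf⟩ : (LocalSubring.ofPrime A P).toSubring)
  have h' : f * ((s : A) : K) = (a : K) := congrArg Subtype.val h
  have hs : IsUnit (algebraMap A (LocalSubring.ofPrime A P).toSubring s) :=
    IsLocalization.map_units _ s
  have hs' := isUnit_subring_iff.1 hs
  have h0 : ((s : A) : K) ≠ 0 := hs'.1
  refine ⟨a, a.2, s, s.1.2, h0, hs'.2, ?_⟩
  rw [← h', mul_assoc, mul_inv_cancel₀ h0, mul_one]

theorem inv_mem_ofPrime_iff {A : Subring K} {P : Ideal A} [P.IsPrime] {a : A} :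
    (a : K) ≠ 0 ∧ (a : K)⁻¹ ∈ (LocalSubring.ofPrime A P).toSubring ↔ a ∉ P := by
  have h := IsLocalization.AtPrime.isUnit_to_map_iff (LocalSubring.ofPrime A P).toSubring P a
  rw [isUnit_subring_iff] at h
  exact h

/-- The center of a local ring containing `A` on `Spec A`. -/
def center (A : Subring K) (V : LocalSubring K) (h : A ≤ V.toSubring) : Ideal A :=
  (IsLocalRing.maximalIdeal V.toSubring).comap (Subring.inclusion h)

instance (A : Subring K) (V : LocalSubring K) (h : A ≤ V.toSubring) : (center A V h).IsPrime :=
  Ideal.comap_isPrime _ _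

theorem mem_center_iff {A : Subring K} {V : LocalSubring K} (h : A ≤ V.toSubring) {a : A} :
    a ∈ center A V h ↔ ¬ ((a : K) ≠ 0 ∧ (a : K)⁻¹ ∈ V.toSubring) := by
  rw [center, Ideal.mem_comap, IsLocalRing.mem_maximalIdeal, mem_nonunits_iff, isUnit_subring_iff]
  rfl

/-- An element of A becomes a unit in the localization at the center exactly when it is a unit of V;
fractions reduce to this case. -/
theorem ofPrime_center_le {A : Subring K} {V : LocalSubring K} (h : A ≤ V.toSubring) :
    LocalSubring.ofPrime A (center A V h) ≤ V := by
  have hinv : ∀ s : A, (s : K)≠ 0 →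
      ((s : K)⁻¹ ∈ (LocalSubring.ofPrime A (center A V h)).toSubring ↔ (s : K)⁻¹ ∈ V.toSubring) := by
    intro s hs
    have h1 := inv_mem_ofPrime_iff (P := center A V h) (a := s)
    rw [mem_center_iff, not_not] at h1
    simpa [hs] using h1
  have hle : (LocalSubring.ofPrime A (center A V h)).toSubring ≤ V.toSubring := by
    intro f hf
    obtain ⟨a, ha, s, hs, h0, hi, rfl⟩ := (isLocAt_ofPrime A (center A V h)).2 f hf
    exact mul_mem (h ha) ((hinv ⟨s, hs⟩ h0).1 hi)
  refine localSubring_le_iff.2 ⟨hle, fun f hf hfi => ?_⟩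
  obtain ⟨a, ha, s, hs, h0, hi, rfl⟩ := (isLocAt_ofPrime A (center A V h)).2 f hf
  by_cases ha0 : a = 0
  · simp [ha0]
  rw [mul_inv, inv_inv] at hfi ⊢
  refine mul_mem ((hinv ⟨a, ha⟩ ha0).2 ?_) (LocalSubring.le_ofPrime _ _ hs)
  have : a⁻¹ = a⁻¹ * s * s⁻¹ := by field_simp
  change a⁻¹ ∈ _
  rw [this]
  exact mul_mem hfi ((hinv ⟨s, hs⟩ h0).1 hi)

/-- A denominator invertible in S is invertible in V, hence in T because V dominates T. This is the
source of all the separatedness statements. -/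
theorem IsLocAt.le_of_le {A : Subring K} {S T V : LocalSubring K} (hS : IsLocAt A S)
    (hSV : S ≤ V) (hTV : T ≤ V) (hAT : A ≤ T.toSubring) : S.toSubring ≤ T.toSubring := by
  intro f hf
  obtain ⟨a, ha, s, hs, h0, hi, rfl⟩ := hS.2 f hf
  exact mul_mem (hAT ha) ((localSubring_le_iff.1 hTV).2 s (hAT hs) (hSV.1 hi))

theorem IsLocAt.eq_of_le {A B : Subring K} {S T V : LocalSubring K} (hS : IsLocAt A S)
    (hT : IsLocAt B T) (hSV : S ≤ V) (hTV : T ≤ V) (hAT : A ≤ T.toSubring)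
    (hBS : B ≤ S.toSubring) : S = T :=
  LocalSubring.toSubring_injective
    (le_antisymm (hS.le_of_le hSV hTV hAT) (hT.le_of_le hTV hSV hBS))

theorem IsLocAt.eq_ofPrime {A : Subring K} {V : LocalSubring K} (h : IsLocAt A V) :
    V = LocalSubring.ofPrime A (center A V h.1) :=
  h.eq_of_le (isLocAt_ofPrime _ _) le_rfl (ofPrime_center_le h.1) (LocalSubring.le_ofPrime _ _) h.1

theorem isLocAt_self (V : LocalSubring K) : IsLocAt V.toSubring V :=
  ⟨le_rfl, fun f hf => ⟨f, hf, 1, one_mem _, one_ne_zero, by simp, by simp⟩⟩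

theorem IsLocAt.trans {A : Subring K} {S V : LocalSubring K} (hS : IsLocAt A S)
    (hV : IsLocAt S.toSubring V) : IsLocAt A V := by
  refine ⟨hS.1.trans hV.1, fun f hf => ?_⟩
  obtain ⟨a, ha, s, hs, h0, hi, rfl⟩ := hV.2 f hf
  obtain ⟨a₁, ha₁, b₁, hb₁, hb0, hbi, rfl⟩ := hS.2 a ha
  obtain ⟨s₁, hs₁, c₁, hc₁, hc0, hci, rfl⟩ := hS.2 s hs
  have hs0 : s₁ ≠ 0 := left_ne_zero_of_mul h0
  refine ⟨a₁ * c₁, mul_mem ha₁ hc₁, b₁ * s₁, mul_mem hb₁ hs₁, mul_ne_zero hb0 hs0, ?_, ?_⟩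
  · have : (b₁ * s₁)⁻¹ = b₁⁻¹ * ((s₁ * c₁⁻¹)⁻¹ * c₁⁻¹) := by field_simp
    rw [this]
    exact mul_mem (hV.1 hbi) (mul_mem hi (hV.1 hci))
  · field_simp

/-- A localization of `A` is a localization of every intermediate ring. -/
theorem IsLocAt.of_le {A B : Subring K} {V : LocalSubring K} (hV : IsLocAt A V)
    (hAB : A ≤ B) (hBV : B ≤ V.toSubring) : IsLocAt B V := by
  refine ⟨hBV, fun f hf => ?_⟩
  obtain ⟨a, ha, s, hs, h⟩ := hV.2 f hf
  exact ⟨a, hAB ha, s, hAB hs, h⟩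

theorem IsLocAt.isNoetherianRing {A : Subring K} {V : LocalSubring K} (h : IsLocAt A V)
    [IsNoetherianRing A] : IsNoetherianRing V.toSubring := by
  rw [h.eq_ofPrime]
  exact IsLocalization.isNoetherianRing (center A V h.1).primeCompl _ inferInstance

/-- Every ideal of a localization is generated by its elements in the base ring. -/
theorem IsLocAt.ideal_le {A : Subring K} {V : LocalSubring K} (h : IsLocAt A V)
    {I J : Ideal V.toSubring}
    (hIJ : I.comap (Subring.inclusion h.1) ≤ J.comap (Subring.inclusion h.1)) : I ≤ J := by
  rintro ⟨f, hf⟩ hfI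
  obtain ⟨a, ha, s, hs, h0, hi, rfl⟩ := h.2 f hf
  have h1 : (⟨a, ha⟩ : A) ∈ I.comap (Subring.inclusion h.1) := by
    rw [Ideal.mem_comap]
    have := I.mul_mem_left ⟨s, h.1 hs⟩ hfI
    convert this using 1
    apply Subtype.ext
    change a = s * (a * s⁻¹)
    field_simp
  have h2 := J.mul_mem_left ⟨s⁻¹, hi⟩ (hIJ h1)
  convert h2 using 1
  apply Subtype.ext
  change a * s⁻¹ = s⁻¹ * a
  ring

/-- A prime element of `A` that is not a unit in the localization stays prime. -/
theorem IsLocAt.prime {A : Subring K} {V : LocalSubring K} (h : IsLocAt A V) {u : A}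
    (hu : Prime u) (hn : (u : K)⁻¹ ∉ V.toSubring) :
    Prime (Subring.inclusion h.1 u : V.toSubring) := by
  have h0 : (u : K) ≠ 0 := fun e => hu.ne_zero (Subtype.ext e)
  have key : ∀ s : A, (s : K) ≠ 0 → (s : K)⁻¹ ∈ V.toSubring → ¬ u ∣ s := by
    rintro s hs hi ⟨c, rfl⟩
    apply hn
    have : (u : K)⁻¹ = ((u * c : A) : K)⁻¹ * c := by
      have hc : (c : K) ≠ 0 := fun e => hs (by simp [e])
      push_cast
      field_simp
    rw [this]
    exact mul_mem hi (h.1 c.2)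
  refine ⟨fun e => h0 (congrArg Subtype.val e), fun e => hn (isUnit_subring_iff.1 e).2, ?_⟩
  rintro ⟨f, hf⟩ ⟨g, hg⟩ ⟨⟨e, he⟩, hfg⟩
  obtain ⟨a, ha, s, hs, hs0, hsi, rfl⟩ := h.2 f hf
  obtain ⟨b, hb, r, hr, hr0, hri, rfl⟩ := h.2 g hg
  obtain ⟨c, hc, q, hq, hq0, hqi, rfl⟩ := h.2 e he
  have hfg' : a * s⁻¹ * (b * r⁻¹) = u * (c * q⁻¹) := congrArg Subtype.val hfg
  have hd : u ∣ (⟨a, ha⟩ * ⟨b, hb⟩) * ⟨q, hq⟩ := by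
    refine ⟨⟨c, hc⟩ * ⟨s, hs⟩ * ⟨r, hr⟩, Subtype.ext ?_⟩
    change a * b * q = u * (c * s * r)
    field_simp at hfg'
    linear_combination hfg'
  rcases hu.dvd_or_dvd hd with hd | hd
  · rcases hu.dvd_or_dvd hd with ⟨c, hc⟩ | ⟨c, hc⟩
    · left
      refine ⟨⟨c * s⁻¹, mul_mem (h.1 c.2) hsi⟩, Subtype.ext ?_⟩
      have : a = u * c := congrArg Subtype.val hc
      change a * s⁻¹ = u * (c * s⁻¹)
      rw [this, mul_assoc]
    · right
      refine ⟨⟨c * r⁻¹, mul_mem (h.1 c.2) hri⟩, Subtype.ext ?_⟩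
      have : b = u * c := congrArg Subtype.val hc
      change b * r⁻¹ = u * (c * r⁻¹)
      rw [this, mul_assoc]
  · exact absurd hd (key _ hq0 hqi)

end Generalities

theorem mem_affineModel_iff {A : Subring RatFun} {V : LocalSubring RatFun} :
    V ∈ affineModel A ↔ IsLocAt A V := by
  constructor
  · rintro ⟨P, hP, rfl⟩
    exact isLocAt_ofPrime A P
  · intro h
    exact ⟨_, inferInstance, h.eq_ofPrime⟩

theorem mem_vanishingSet_iff {R : LocalSubring RatFun} {a : RatFun} :
    a ∈ vanishingSet R ↔ a ∈ R.toSubring ∧ ¬ (a ≠ 0 ∧ a⁻¹ ∈ R.toSubring) := by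
  constructor
  · rintro ⟨h, hm⟩
    rw [IsLocalRing.mem_maximalIdeal, mem_nonunits_iff, isUnit_subring_iff] at hm
    exact ⟨h, hm⟩
  · rintro ⟨h, hm⟩
    refine ⟨h, ?_⟩
    rw [IsLocalRing.mem_maximalIdeal, mem_nonunits_iff, isUnit_subring_iff]
    exact hm

theorem mem_vanishingSet_of_le {R S : LocalSubring RatFun} (h : R ≤ S) {a : RatFun}
    (ha : a ∈ R.toSubring) : a ∈ vanishingSet S ↔ a ∈ vanishingSet R := by
  rw [mem_vanishingSet_iff, mem_vanishingSet_iff]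
  have := (localSubring_le_iff.1 h)
  constructor
  · rintro ⟨_, h2⟩
    exact ⟨ha, fun h3 => h2 ⟨h3.1, this.1 h3.2⟩⟩
  · rintro ⟨_, h2⟩
    exact ⟨this.1 ha, fun h3 => h2 ⟨h3.1, this.2 a ha h3.2⟩⟩

/-! ### Factoriality from a prime element with principal quotient. -/

section PrincipalModulo

variable {A B C : Type*} [CommRing A] [CommRing B] [CommRing C]

/-- Every ideal that contains `u` is generated by `u` and one more element, that is, `A ⧸ (u)` is a
principal ideal ring. -/
def PrincipalModulo (u : A) : Prop :=
  ∀ I : Ideal A, u ∈ I → ∃ g, I = Ideal.span {u, g}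

/-- The hypothesis makes B/(u) a quotient of the principal ideal ring C, so a generator of the image
of I in C lifts to the second generator of I. -/
theorem PrincipalModulo.of_surjective [IsPrincipalIdealRing C] (f : A →+* C)
    (hf : Function.Surjective f) (g : A →+* B) (hg : Function.Surjective g) {u : B}
    (h : ∀ a, f a = 0 → u ∣ g a) : PrincipalModulo u := by
  intro I hu
  obtain ⟨c, hc⟩ := (IsPrincipalIdealRing.principal ((I.comap g).map f)).principal
  have hc' : (I.comap g).map f = Ideal.span {c} := hc
  have hmem : c ∈ (I.comap g).map f := by rw [hc']; exact Ideal.mem_span_singleton_self c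
  obtain ⟨a, ha, rfl⟩ := (Ideal.mem_map_iff_of_surjective f hf).1 hmem
  refine ⟨g a, le_antisymm ?_ ?_⟩
  · intro x hx
    obtain ⟨y, rfl⟩ := hg x
    have hy : f y ∈ (I.comap g).map f := Ideal.mem_map_of_mem f hx
    rw [hc', Ideal.mem_span_singleton] at hy
    obtain ⟨d, hd⟩ := hy
    obtain ⟨e, rfl⟩ := hf d
    obtain ⟨k, hk⟩ := h (y - a * e) (by simp [hd])
    rw [Ideal.mem_span_pair]
    refine ⟨k, g e, ?_⟩
    rw [map_sub, map_mul] at hk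
    linear_combination -hk
  · rw [Ideal.span_le]
    rintro x (rfl | rfl)
    · exact hu
    · exact ha

/-- The equivalence embeds B/(u) into the domain C; `f` need not be surjective for this. -/
theorem prime_of_surjective [IsDomain C] (f : A →+* C) (g : A →+* B)
    (hg : Function.Surjective g) {u : B} (hu : u ≠ 0)
    (h : ∀ a, f a = 0 ↔ u ∣ g a) : Prime u := by
  refine ⟨hu, fun hunit => ?_, fun x y hxy => ?_⟩
  · have := (h 1).2 hunit.dvd
    simp at this
  · obtain ⟨a, rfl⟩ := hg x
    obtain ⟨b, rfl⟩ := hg y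
    rw [← map_mul, ← h, map_mul, mul_eq_zero, h, h] at hxy
    exact hxy

/-- If `A` is a noetherian domain, `u` is a prime element in its Jacobson radical and `A ⧸ (u)` is a
principal ideal ring, then every prime ideal that does not contain `u` is principal. -/
theorem PrincipalModulo.isPrincipal_of_notMem [IsNoetherianRing A] {u : A}
    (hu : u ∈ Ideal.jacobson (⊥ : Ideal A)) (h : PrincipalModulo u) (P : Ideal A) [P.IsPrime]
    (huP : u ∉ P) : ∃ a, P = Ideal.span {a} := by
  obtain ⟨g, hg⟩ := h (P ⊔ Ideal.span {u})
    (Ideal.mem_sup_right (Ideal.mem_span_singleton_self u))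
  have hgm : g ∈ P ⊔ Ideal.span {u} := by rw [hg]; exact Ideal.subset_span (by simp)
  obtain ⟨a, ha, b, hb, hab⟩ := Submodule.mem_sup.1 hgm
  obtain ⟨r, rfl⟩ := Ideal.mem_span_singleton'.1 hb
  refine ⟨a, le_antisymm ?_ ((Ideal.span_singleton_le_iff_mem _).2 ha)⟩
  -- Nakayama reduces the claim to P ⊆ (a) + uP. With g = a + ru, an element cu + dg of P differs
  -- from da by (c + dr)u, and u ∉ P forces c + dr ∈ P.
  refine Submodule.le_of_le_smul_of_le_jacobson_bot (I := Ideal.span {u})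
    (IsNoetherian.noetherian P) ((Ideal.span_singleton_le_iff_mem _).2 hu) ?_
  intro x hx
  have hx' : x ∈ Ideal.span {u, g} := by rw [← hg]; exact Ideal.mem_sup_left hx
  obtain ⟨c, d, rfl⟩ := Ideal.mem_span_pair.1 hx'
  have h1 : (c + d * r) * u ∈ P := by
    have := P.sub_mem hx (P.mul_mem_left d ha)
    convert this using 1
    rw [← hab]; ring
  have h2 := (Ideal.IsPrime.mem_or_mem inferInstance h1).resolve_right huP
  have : c * u + d * g = d * a + u * (c + d * r) := by rw [← hab]; ring
  rw [this]
  refine add_mem (Ideal.mem_sup_left (Ideal.mul_mem_left _ _ (Ideal.mem_span_singleton_self a)))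
    (Ideal.mem_sup_right ?_)
  exact Submodule.smul_mem_smul (Ideal.mem_span_singleton_self u) h2

/-- Kaplansky's criterion: a nonzero prime ideal contains the prime element u, or else it is
principal and its generator is prime. -/
theorem PrincipalModulo.uniqueFactorizationMonoid [IsDomain A] [IsNoetherianRing A] {u : A}
    (hp : Prime u) (hu : u ∈ Ideal.jacobson (⊥ : Ideal A)) (h : PrincipalModulo u) :
    UniqueFactorizationMonoid A := by
  refine UniqueFactorizationMonoid.iff_exists_prime_mem_of_isPrime.mpr fun P h0 hP => ?_
  by_cases huP : u ∈ P
  · exact ⟨u, huP, hp⟩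
  · obtain ⟨a, rfl⟩ := h.isPrincipal_of_notMem hu P huP
    refine ⟨a, Ideal.mem_span_singleton_self a, (Ideal.span_singleton_prime ?_).1 hP⟩
    rintro rfl
    exact h0 (by simp)

end PrincipalModulo

theorem IsLocAt.principalModulo {K : Type*} [Field K] {A : Subring K} {V : LocalSubring K}
    (h : IsLocAt A V) {u : A} (hu : PrincipalModulo u) :
    PrincipalModulo (Subring.inclusion h.1 u : V.toSubring) := by
  intro I hI
  obtain ⟨g, hg⟩ := hu (I.comap (Subring.inclusion h.1)) hI
  refine ⟨Subring.inclusion h.1 g, le_antisymm (h.ideal_le ?_) ?_⟩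
  · rw [hg, Ideal.span_le]
    rintro x (rfl | rfl)
    · exact Ideal.subset_span (by simp)
    · exact Ideal.subset_span (by simp)
  · have hgI : g ∈ I.comap (Subring.inclusion h.1) := by
      rw [hg]; exact Ideal.subset_span (by simp)
    rw [Ideal.span_le]
    rintro x (rfl | rfl)
    · exact hI
    · exact hgI

/-- The local rings that occur on the surfaces obtained from `ℙ¹ × ℙ¹` by blowups: noetherian, with
fraction field `ℂ(x, y)`, and either a field, or with a prime element modulo which all ideals are
principal. -/
structure IsRegularPoint (R : LocalSubring RatFun) : Prop where
  noetherian : IsNoetherianRing R.toSubring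
  frac : ∀ f : RatFun, ∃ a ∈ R.toSubring, ∃ b ∈ R.toSubring, b ≠ 0 ∧ f = a * b⁻¹
  regular : (∀ a ∈ R.toSubring, a⁻¹ ∈ R.toSubring) ∨
    ∃ u : R.toSubring, Prime u ∧ PrincipalModulo u

theorem IsRegularPoint.uniqueFactorizationMonoid {R : LocalSubring RatFun}
    (h : IsRegularPoint R) : UniqueFactorizationMonoid R.toSubring := by
  have := h.noetherian
  rcases h.regular with hf | ⟨u, hu, hP⟩
  · refine UniqueFactorizationMonoid.iff_exists_prime_mem_of_isPrime.mpr fun P h0 hP => ?_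
    obtain ⟨a, ha, ha0⟩ := Submodule.exists_mem_ne_zero_of_ne_bot h0
    refine absurd (Ideal.eq_top_of_isUnit_mem _ ha (isUnit_subring_iff.2
      ⟨fun e => ha0 (Subtype.ext e), hf a a.2⟩)) hP.ne_top
  · refine hP.uniqueFactorizationMonoid hu ?_
    rw [IsLocalRing.jacobson_eq_maximalIdeal _ bot_ne_top, IsLocalRing.mem_maximalIdeal]
    exact hu.not_isUnit

/-! ### Blowing up preserves regularity of local rings. -/

section Blowup

variable {R S : LocalSubring RatFun} {t : RatFun}

theorem le_blowupChart : R.toSubring ≤ blowupChart R t :=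
  fun _ ha => Subring.subset_closure (Or.inl ha)

theorem div_mem_blowupChart {a : RatFun} (ha : a ∈ vanishingSet R) : a / t ∈ blowupChart R t :=
  Subring.subset_closure (Or.inr ⟨a, ha, rfl⟩)

theorem blowupChart_le {T : Subring RatFun} (h : R.toSubring ≤ T)
    (h' : ∀ a ∈ vanishingSet R, a / t ∈ T) : blowupChart R t ≤ T := by
  rw [blowupChart, Subring.closure_le]
  rintro x (hx | ⟨a, ha, rfl⟩)
  · exact h hx
  · exact h' a ha

theorem one_notMem_vanishingSet : (1 : RatFun) ∉ vanishingSet S := by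
  rw [mem_vanishingSet_iff]
  rintro ⟨-, h⟩
  exact h ⟨one_ne_zero, by simp⟩

theorem mul_mem_vanishingSet {a b : RatFun} (ha : a ∈ vanishingSet S) (hb : b ∈ S.toSubring) :
    a * b ∈ vanishingSet S := by
  obtain ⟨h, hm⟩ := ha
  exact ⟨mul_mem h hb, Ideal.mul_mem_right (⟨b, hb⟩ : S.toSubring) _ hm⟩

theorem add_mem_vanishingSet {a b : RatFun} (ha : a ∈ vanishingSet S) (hb : b ∈ vanishingSet S) :
    a + b ∈ vanishingSet S := by
  obtain ⟨h, hm⟩ := ha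
  obtain ⟨h', hm'⟩ := hb
  exact ⟨add_mem h h', Ideal.add_mem _ hm hm'⟩

/-- A polynomial relation between the generators of the chart has coefficients in the maximal
ideal. -/
theorem coeff_mem_of_sum_eq_zero {A : Subring RatFun} {I : Ideal A} {t w : A} (ht : Prime t)
    (htw : ¬ t ∣ w) (htI : t ∈ I) (hwI : w ∈ I) (d : ℕ) (a : ℕ → A)
    (h : ∑ i ∈ Finset.range d, (a i : RatFun) * ((w : RatFun) / t) ^ i = 0) :
    ∀ i < d, a i ∈ I := by
  have ht0 : (t : RatFun) ≠ 0 := fun e => ht.ne_zero (Subtype.ext e)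
  induction d generalizing a with
  | zero => intro i hi; omega
  | succ d ih =>
    -- Clearing denominators by t ^ d leaves every term except the leading one divisible by t.
    have hdvd : t ∣ a d * w ^ d := by
      have hsum : (a d : RatFun) * (w : RatFun) ^ d =
          -(∑ i ∈ Finset.range d, (a i : RatFun) * (w : RatFun) ^ i * (t : RatFun) ^ (d - i)) := by
        rw [Finset.sum_range_succ] at h
        have h1 : (a d : RatFun) * (w : RatFun) ^ d =
            (a d : RatFun) * ((w : RatFun) / t) ^ d * (t : RatFun) ^ d := by
          rw [div_pow]; field_simp
        rw [h1, eq_neg_of_add_eq_zero_right h, neg_mul, Finset.sum_mul]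
        congr 1
        refine Finset.sum_congr rfl fun i hi => ?_
        have hid : i ≤ d := (Finset.mem_range.1 hi).le
        rw [div_pow, ← Nat.sub_add_cancel hid, pow_add, Nat.add_sub_cancel]
        field_simp
      have hsum' : a d * w ^ d = -(∑ i ∈ Finset.range d, a i * w ^ i * t ^ (d - i)) := by
        apply Subtype.ext
        push_cast
        exact hsum
      rw [hsum', dvd_neg]
      refine Finset.dvd_sum fun i hi => Dvd.dvd.mul_left (dvd_pow_self t ?_) _
      have := Finset.mem_range.1 hi
      omega
    have had : t ∣ a d := (ht.dvd_or_dvd hdvd).resolve_right fun h => htw (ht.dvd_of_dvd_pow h)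
    obtain ⟨b, hb⟩ := had
    cases d with
    | zero =>
      intro i hi
      obtain rfl : i = 0 := by omega
      rw [hb]; exact I.mul_mem_right _ htI
    | succ d =>
      -- The leading coefficient is tb, so its term equals bw(w/t)^d and can be absorbed into the
      -- next one. This shortens the relation and changes a coefficient only by a multiple of w ∈ I.
      have key := ih (fun i => if i = d then a d + b * w else a i) (by
        rw [Finset.sum_range_succ, Finset.sum_range_succ] at h
        rw [Finset.sum_range_succ, if_pos rfl]
        rw [Finset.sum_congr rfl (g := fun i => (a i : RatFun) * ((w : RatFun) / t) ^ i)]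
        · rw [hb] at h
          push_cast at h ⊢
          have h2 : (t : RatFun) * b * ((w : RatFun) / t) ^ (d + 1) =
              b * w * ((w : RatFun) / t) ^ d := by
            rw [pow_succ]; field_simp
          rw [h2] at h
          linear_combination h
        · intro i hi
          have := Finset.mem_range.1 hi
          rw [if_neg (by omega)])
      intro i hi
      rcases Nat.lt_succ_iff_lt_or_eq.1 hi with hi | rfl
      · have := key i hi
        split_ifs at this with hid
        · subst hid
          exact (I.add_mem_iff_left (I.mul_mem_left b hwI)).1 this
        · exact this
      · rw [hb]; exact I.mul_mem_right _ htI

end Blowup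

section Blowup

variable {R S : LocalSubring RatFun} {t : RatFun}

theorem coe_mem_vanishingSet_iff {a : R.toSubring} :
    (a : RatFun) ∈ vanishingSet R ↔ a ∈ IsLocalRing.maximalIdeal R.toSubring :=
  ⟨fun ⟨_, h⟩ => h, fun h => ⟨a.2, h⟩⟩

/-- Dividing by t would write 1 as a(b/t) + c(d/t), which vanishes at S. This encodes t ∉ 𝔪² for
sums of two products, enough for a maximal ideal with two generators. -/
theorem one_ne_add_of_le_of_blowupChart_le (hRS : R ≤ S) (hS : blowupChart R t ≤ S.toSubring)
    {a b c d : RatFun} (ha : a ∈ vanishingSet R) (hb : b ∈ vanishingSet R)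
    (hc : c ∈ vanishingSet R) (hd : d ∈ vanishingSet R) (ht : t ≠ 0) : t ≠ a * b + c * d := by
  intro h
  have h1 : (1 : RatFun) = a * (b / t) + c * (d / t) := by
    field_simp
    exact h
  apply one_notMem_vanishingSet (S := S)
  rw [h1]
  exact add_mem_vanishingSet
    (mul_mem_vanishingSet ((mem_vanishingSet_of_le hRS ha.1).2 ha) (hS (div_mem_blowupChart hb)))
    (mul_mem_vanishingSet ((mem_vanishingSet_of_le hRS hc.1).2 hc) (hS (div_mem_blowupChart hd)))

theorem irreducible_of_blowupChart_le (hRS : R ≤ S) (hS : blowupChart R t ≤ S.toSubring)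
    {t' : R.toSubring} (htt' : (t' : RatFun) = t) (ht : t ≠ 0) (htR : t ∈ vanishingSet R) :
    Irreducible t' := by
  have hz : (0 : RatFun) ∈ vanishingSet R := by
    rw [mem_vanishingSet_iff]; exact ⟨zero_mem _, fun h => h.1 rfl⟩
  refine ⟨fun hu => ?_, fun a b hab => ?_⟩
  · rw [← htt', coe_mem_vanishingSet_iff] at htR
    exact htR hu
  · by_contra! hcon
    refine one_ne_add_of_le_of_blowupChart_le hRS hS (a := a) (b := b) (c := 0) (d := 0)
      (coe_mem_vanishingSet_iff.2 hcon.1) (coe_mem_vanishingSet_iff.2 hcon.2) hz hz ht ?_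
    rw [← htt', hab]
    push_cast
    ring

/-- Write 𝔪 = (u, g) and t = αu + βg. Since t ∉ 𝔪², one of α, β is a unit, and t can replace the
corresponding generator. -/
theorem exists_maximalIdeal_eq_span_pair (hR : IsRegularPoint R) (hRS : R ≤ S)
    (hS : blowupChart R t ≤ S.toSubring) {t' : R.toSubring} (htt' : (t' : RatFun) = t)
    (ht : t ≠ 0) (htR : t ∈ vanishingSet R) :
    ∃ w, IsLocalRing.maximalIdeal R.toSubring = Ideal.span {t', w} := by
  rcases hR.regular with hf | ⟨u, hu, hP⟩
  · rw [mem_vanishingSet_iff] at htR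
    exact absurd ⟨ht, hf t htR.1⟩ htR.2
  have htm : t' ∈ IsLocalRing.maximalIdeal R.toSubring := by
    rw [← coe_mem_vanishingSet_iff, htt']; exact htR
  obtain ⟨g, hg⟩ := hP (IsLocalRing.maximalIdeal R.toSubring) hu.not_isUnit
  have hgm : g ∈ IsLocalRing.maximalIdeal R.toSubring := by
    rw [hg]; exact Ideal.subset_span (by simp)
  have hum : u ∈ IsLocalRing.maximalIdeal R.toSubring := hu.not_isUnit
  have htm' := htm
  rw [hg] at htm'
  obtain ⟨α, β, hαβ⟩ := Ideal.mem_span_pair.1 htm'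
  by_cases hα : IsUnit α
  · refine ⟨g, le_antisymm ?_ ?_⟩
    · rw [hg, Ideal.span_le]
      obtain ⟨γ, hγ⟩ := hα.exists_left_inv
      rintro x (rfl | rfl)
      · refine Ideal.mem_span_pair.2 ⟨γ, -γ * β, ?_⟩
        rw [← hαβ]
        linear_combination x * hγ
      · exact Ideal.subset_span (by simp)
    · rw [Ideal.span_le]
      rintro x (rfl | rfl)
      exacts [htm, hgm]
  by_cases hβ : IsUnit β
  · refine ⟨u, le_antisymm ?_ ?_⟩
    · rw [hg, Ideal.span_le]
      obtain ⟨γ, hγ⟩ := hβ.exists_left_inv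
      rintro x (rfl | rfl)
      · exact Ideal.subset_span (by simp)
      · refine Ideal.mem_span_pair.2 ⟨γ, -γ * α, ?_⟩
        rw [← hαβ]
        linear_combination x * hγ
    · rw [Ideal.span_le]
      rintro x (rfl | rfl)
      exacts [htm, hum]
  · refine absurd ?_ (one_ne_add_of_le_of_blowupChart_le hRS hS (a := α) (b := u) (c := β) (d := g)
      (coe_mem_vanishingSet_iff.2 hα) (coe_mem_vanishingSet_iff.2 hum)
      (coe_mem_vanishingSet_iff.2 hβ) (coe_mem_vanishingSet_iff.2 hgm) ht)
    rw [← htt', ← hαβ]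
    push_cast
    rfl

/-- The parametrization of a chart of the blowup by a polynomial ring. -/
def chartHom (R : LocalSubring RatFun) (t : RatFun) {w : R.toSubring}
    (hw : w ∈ IsLocalRing.maximalIdeal R.toSubring) : Polynomial R.toSubring →+* blowupChart R t :=
  Polynomial.eval₂RingHom (Subring.inclusion le_blowupChart)
    ⟨(w : RatFun) / t, div_mem_blowupChart (coe_mem_vanishingSet_iff.2 hw)⟩

theorem chartHom_C {w : R.toSubring} (hw : w ∈ IsLocalRing.maximalIdeal R.toSubring)
    (a : R.toSubring) : (chartHom R t hw (Polynomial.C a) : RatFun) = a := by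
  simp [chartHom]

theorem chartHom_X {w : R.toSubring} (hw : w ∈ IsLocalRing.maximalIdeal R.toSubring) :
    (chartHom R t hw Polynomial.X : RatFun) = w / t := by
  simp [chartHom]

theorem chartHom_surjective {w t' : R.toSubring} (htt' : (t' : RatFun) = t) (ht : t ≠ 0)
    (hw : w ∈ IsLocalRing.maximalIdeal R.toSubring)
    (hm : IsLocalRing.maximalIdeal R.toSubring = Ideal.span {t', w}) :
    Function.Surjective (chartHom R t hw) := by
  have h : blowupChart R t ≤ ((blowupChart R t).subtype.comp (chartHom R t hw)).range := by
    refine blowupChart_le (fun a ha => ⟨Polynomial.C ⟨a, ha⟩, chartHom_C hw _⟩) ?_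
    rintro a ⟨haR, ham⟩
    rw [hm] at ham
    obtain ⟨α, β, hαβ⟩ := Ideal.mem_span_pair.1 ham
    refine ⟨Polynomial.C α + Polynomial.C β * Polynomial.X, ?_⟩
    have ha : (α : RatFun) * t' + β * w = a := congrArg Subtype.val hαβ
    rw [map_add, map_mul]
    change (chartHom R t hw (Polynomial.C α) : RatFun) + (chartHom R t hw (Polynomial.C β) : RatFun)
      * (chartHom R t hw Polynomial.X : RatFun) = a / t
    rw [chartHom_C, chartHom_C, chartHom_X, ← ha, htt']
    field_simp
  rintro ⟨b, hb⟩
  obtain ⟨F, hF⟩ := h hb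
  exact ⟨F, Subtype.ext hF⟩

theorem coeff_mem_of_chartHom_eq_zero {w t' : R.toSubring} (htt' : (t' : RatFun) = t)
    (hw : w ∈ IsLocalRing.maximalIdeal R.toSubring) (htp : Prime t') (htw : ¬ t' ∣ w)
    {F : Polynomial R.toSubring} (hF : chartHom R t hw F = 0) (i : ℕ) :
    F.coeff i ∈ IsLocalRing.maximalIdeal R.toSubring := by
  have hsum : ∑ i ∈ Finset.range (F.natDegree + 1),
      (F.coeff i : RatFun) * ((w : RatFun) / t') ^ i = 0 := by
    have h := congrArg Subtype.val hF
    rw [chartHom, Polynomial.coe_eval₂RingHom, Polynomial.eval₂_eq_sum_range] at h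
    push_cast at h
    rw [htt']
    exact h
  rcases lt_or_ge i (F.natDegree + 1) with hi | hi
  · exact coeff_mem_of_sum_eq_zero htp htw htp.not_isUnit hw _ _ hsum i hi
  · rw [Polynomial.coeff_eq_zero_of_natDegree_lt (by omega)]
    exact zero_mem _

theorem map_residue_eq_zero_iff {F : Polynomial R.toSubring} :
    F.map (IsLocalRing.residue R.toSubring) = 0 ↔
      ∀ i, F.coeff i ∈ IsLocalRing.maximalIdeal R.toSubring := by
  simp only [Polynomial.ext_iff, Polynomial.coeff_map, Polynomial.coeff_zero,
    IsLocalRing.residue_eq_zero_iff]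

/-- This identifies the chart modulo t with the polynomial ring over the residue field. Elements of
𝔪 are multiples of t in the chart; conversely, if F maps to t times the image of G, then F − tG is a
relation, so its coefficients lie in 𝔪. -/
theorem map_residue_eq_zero_iff_dvd_chartHom {w t' : R.toSubring} (htt' : (t' : RatFun) = t)
    (ht : t ≠ 0) (hw : w ∈ IsLocalRing.maximalIdeal R.toSubring)
    (hm : IsLocalRing.maximalIdeal R.toSubring = Ideal.span {t', w})
    (htp : Prime t') (htw : ¬ t' ∣ w) (F : Polynomial R.toSubring) :
    F.map (IsLocalRing.residue R.toSubring) = 0 ↔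
      Subring.inclusion le_blowupChart t' ∣ chartHom R t hw F := by
  rw [map_residue_eq_zero_iff]
  constructor
  · intro h
    rw [F.as_sum_range_C_mul_X_pow, map_sum]
    refine Finset.dvd_sum fun i _ => ?_
    rw [map_mul]
    refine Dvd.dvd.mul_right ⟨⟨_, div_mem_blowupChart (coe_mem_vanishingSet_iff.2 (h i))⟩, ?_⟩ _
    apply Subtype.ext
    rw [chartHom_C]
    change _ = (t' : RatFun) * (_ / t)
    rw [htt']
    field_simp
  · rintro ⟨b, hb⟩ i
    obtain ⟨G, rfl⟩ := chartHom_surjective htt' ht hw hm b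
    have h0 : chartHom R t hw (F - Polynomial.C t' * G) = 0 := by
      rw [map_sub, map_mul, hb, sub_eq_zero]
      congr 1
      exact Subtype.ext (chartHom_C hw t').symm
    have h1 := coeff_mem_of_chartHom_eq_zero htt' hw htp htw h0 i
    rw [Polynomial.coeff_sub, Polynomial.coeff_C_mul] at h1
    have h2 : t' * G.coeff i ∈ IsLocalRing.maximalIdeal R.toSubring :=
      Ideal.mul_mem_right _ _ htp.not_isUnit
    have := add_mem h1 h2
    rwa [sub_add_cancel] at this

/-- Blowing up a point replaces a regular point by regular points. -/
theorem IsRegularPoint.of_blowupChart (hR : IsRegularPoint R) (hRS : R ≤ S) (ht : t ≠ 0)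
    (htR : t ∈ vanishingSet R) (hS : IsLocAt (blowupChart R t) S) : IsRegularPoint S := by
  have hnoeth := hR.noetherian
  obtain ⟨t', htt'⟩ : ∃ t' : R.toSubring, (t' : RatFun) = t := ⟨⟨t, htR.1⟩, rfl⟩
  have hirr := irreducible_of_blowupChart_le hRS hS.1 htt' ht htR
  obtain ⟨w, hm⟩ := exists_maximalIdeal_eq_span_pair hR hRS hS.1 htt' ht htR
  have := hR.uniqueFactorizationMonoid
  have htp : Prime t' := UniqueFactorizationMonoid.irreducible_iff_prime.1 hirr
  have hw : w ∈ IsLocalRing.maximalIdeal R.toSubring := by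
    rw [hm]; exact Ideal.subset_span (by simp)
  -- If t divides w, then 𝔪 = (t), the chart is R itself and S = R.
  by_cases htw : t' ∣ w
  · have hB : blowupChart R t ≤ R.toSubring := by
      refine blowupChart_le le_rfl ?_
      rintro a ⟨haR, ham⟩
      rw [hm] at ham
      obtain ⟨α, β, hαβ⟩ := Ideal.mem_span_pair.1 ham
      obtain ⟨c, rfl⟩ := htw
      have ha : (α : RatFun) * t' + β * (t' * c) = a := congrArg Subtype.val hαβ
      have : a / t = α + β * c := by
        rw [← ha, htt']; field_simp
      rw [this]
      exact add_mem α.2 (mul_mem β.2 c.2)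
    have : R = S :=
      (isLocAt_self R).eq_of_le hS hRS le_rfl hRS.1 hB
    exact this ▸ hR
  have hsurj := chartHom_surjective htt' ht hw hm
  have hiff := map_residue_eq_zero_iff_dvd_chartHom htt' ht hw hm htp htw
  have hBnoeth : IsNoetherianRing (blowupChart R t) := isNoetherianRing_of_surjective _ _ _ hsurj
  refine ⟨hS.isNoetherianRing, fun f => ?_, Or.inr ?_⟩
  · obtain ⟨a, ha, b, hb, h⟩ := hR.frac f
    exact ⟨a, hRS.1 ha, b, hRS.1 hb, h⟩
  · let T : blowupChart R t := Subring.inclusion le_blowupChart t'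
    have hT0 : T ≠ 0 := fun e => ht (by rw [← htt']; exact congrArg Subtype.val e)
    have hTp : Prime T := prime_of_surjective
      (Polynomial.mapRingHom (IsLocalRing.residue R.toSubring)) (chartHom R t hw) hsurj hT0 hiff
    have hTP : PrincipalModulo T := PrincipalModulo.of_surjective
      (Polynomial.mapRingHom (IsLocalRing.residue R.toSubring))
      (Polynomial.map_surjective _ IsLocalRing.residue_surjective)
      (chartHom R t hw) hsurj (fun a ha => (hiff a).1 ha)
    refine ⟨Subring.inclusion hS.1 T, hS.prime hTp ?_, hS.principalModulo hTP⟩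
    intro hi
    rw [← mem_vanishingSet_of_le hRS htR.1, mem_vanishingSet_iff] at htR
    exact htR.2 ⟨ht, by rw [← htt']; exact hi⟩

end Blowup

/-! ### Localizations at prime elements and their intersection. -/

section LocalizationAtPrimeElement

variable {K : Type*} [Field K] {A : Subring K} {V : LocalSubring K} {u : A}

/-- `V` is the localization of `A` at the prime ideal generated by `u`. -/
def IsLocAtElement (A : Subring K) (u : A) (V : LocalSubring K) : Prop :=
  IsLocAt A V ∧ ∀ a : A, ((a : K) ≠ 0 ∧ (a : K)⁻¹ ∈ V.toSubring) ↔ ¬ u ∣ a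

theorem exists_isLocAtElement (hu : Prime u) : ∃ V, IsLocAtElement A u V := by
  have : (Ideal.span {u}).IsPrime := (Ideal.span_singleton_prime hu.ne_zero).2 hu
  refine ⟨LocalSubring.ofPrime A (Ideal.span {u}), isLocAt_ofPrime _ _, fun a => ?_⟩
  rw [inv_mem_ofPrime_iff, Ideal.mem_span_singleton]

theorem IsLocAtElement.maximalIdeal_eq (h : IsLocAtElement A u V) :
    IsLocalRing.maximalIdeal V.toSubring = Ideal.span {Subring.inclusion h.1.1 u} := by
  have hmem : ∀ a : A, Subring.inclusion h.1.1 a ∈ IsLocalRing.maximalIdeal V.toSubring ↔ u ∣ a := by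
    intro a
    rw [IsLocalRing.mem_maximalIdeal, mem_nonunits_iff, isUnit_subring_iff, ← not_iff_not, not_not]
    exact h.2 a
  apply le_antisymm
  · refine h.1.ideal_le fun a ha => ?_
    rw [Ideal.mem_comap, hmem] at ha
    rw [Ideal.mem_comap, Ideal.mem_span_singleton]
    exact map_dvd _ ha
  · rw [Ideal.span_singleton_le_iff_mem, hmem]

theorem IsLocAtElement.isDiscreteValuationRing [IsNoetherianRing A] (h : IsLocAtElement A u V)
    (hu : Prime u) : IsDiscreteValuationRing V.toSubring := by
  have := h.1.isNoetherianRing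
  have hf : ¬ IsField V.toSubring := by
    rw [IsLocalRing.isField_iff_maximalIdeal_eq, h.maximalIdeal_eq, Ideal.span_singleton_eq_bot]
    intro e
    have e' := congrArg (fun z : V.toSubring => (z : K)) e
    exact hu.ne_zero (Subtype.ext e')
  refine ((IsDiscreteValuationRing.TFAE V.toSubring hf).out 0 4).2 ?_
  exact ⟨⟨_, h.maximalIdeal_eq⟩⟩

theorem IsLocAtElement.irreducible [IsDiscreteValuationRing V.toSubring]
    (h : IsLocAtElement A u V) : Irreducible (Subring.inclusion h.1.1 u) :=
  (IsDiscreteValuationRing.irreducible_iff_uniformizer _).2 h.maximalIdeal_eq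

/-- A noetherian factorial domain is the intersection of its localizations at prime elements. -/
theorem mem_of_forall_isLocAtElement [UniqueFactorizationMonoid A] {f : K}
    (hfrac : ∃ a ∈ A, ∃ b ∈ A, b ≠ 0 ∧ f = a * b⁻¹)
    (h : ∀ u : A, Prime u → ∀ V, IsLocAtElement A u V → f ∈ V.toSubring) : f ∈ A := by
  obtain ⟨a, ha, b, hb, hb0, hf⟩ := hfrac
  have hb0' : (⟨b, hb⟩ : A) ≠ 0 := fun e => hb0 (congrArg Subtype.val e)
  obtain ⟨a', b', c, hrel, hca, hcb⟩ :=
    UniqueFactorizationMonoid.exists_reduced_factors' (⟨a, ha⟩ : A) ⟨b, hb⟩ hb0'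
  have hca' : (c : K) * a' = a := congrArg Subtype.val hca
  have hcb' : (c : K) * b' = b := congrArg Subtype.val hcb
  have hc0 : (c : K) ≠ 0 := by rintro e; rw [e, zero_mul] at hcb'; exact hb0 hcb'.symm
  have hb'0 : (b' : K) ≠ 0 := by rintro e; rw [e, mul_zero] at hcb'; exact hb0 hcb'.symm
  have hf' : f = a' * (b' : K)⁻¹ := by
    rw [hf, ← hca', ← hcb']; field_simp
  by_cases hunit : IsUnit b'
  · rw [hf']
    exact mul_mem a'.2 (isUnit_subring_iff.1 hunit).2
  obtain ⟨u, hu, hub⟩ := WfDvdMonoid.exists_irreducible_factor hunit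
    (fun e => hb'0 (congrArg Subtype.val e))
  have hup : Prime u := UniqueFactorizationMonoid.irreducible_iff_prime.1 hu
  obtain ⟨V, hV⟩ := exists_isLocAtElement hup
  have hua : ¬ u ∣ a' := fun hua => hu.not_isUnit (hrel hua hub)
  have ha' := (hV.2 a').2 hua
  refine absurd hub ((hV.2 b').1 ⟨hb'0, ?_⟩)
  have : (b' : K)⁻¹ = f * (a' : K)⁻¹ := by
    have := ha'.1
    rw [hf']; field_simp
  rw [this]
  exact mul_mem (h u hup V hV) ha'.2

end LocalizationAtPrimeElement

/-! ### Regular separated models and their blowups. -/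

section Models

/-- A valuation ring is maximal for domination among local subrings of its fraction field. -/
theorem eq_of_le_of_isDiscreteValuationRing {Z W : LocalSubring RatFun}
    [IsDiscreteValuationRing Z.toSubring] (hZ : IsRegularPoint Z) (h : Z ≤ W) : Z = W := by
  refine LocalSubring.toSubring_injective (le_antisymm h.1 fun f hf => ?_)
  obtain ⟨a, ha, b, hb, hb0, rfl⟩ := hZ.frac f
  rcases ValuationRing.dvd_total (⟨a, ha⟩ : Z.toSubring) ⟨b, hb⟩ with ⟨c, hc⟩ | ⟨c, hc⟩
  · have hc' : b = a * c := congrArg Subtype.val hc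
    have ha0 : a ≠ 0 := left_ne_zero_of_mul (hc' ▸ hb0)
    have hc0 : (c : RatFun) ≠ 0 := right_ne_zero_of_mul (hc' ▸ hb0)
    have : a * b⁻¹ = (c : RatFun)⁻¹ := by rw [hc']; field_simp
    rw [this] at hf ⊢
    exact (localSubring_le_iff.1 h).2 c c.2 hf
  · have hc' : a = b * c := congrArg Subtype.val hc
    have : a * b⁻¹ = c := by rw [hc']; field_simp
    rw [this]
    exact c.2

/-- The properties of the surfaces obtained from `ℙ¹ × ℙ¹` by blowups that the theory of their
divisors rests on: regularity, separatedness, and that they contain the generic points of the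
curves through each of their points. -/
structure IsRegularModel (X : Model) : Prop where
  regular : ∀ q ∈ X, IsRegularPoint q
  separated : ∀ q₁ ∈ X, ∀ q₂ ∈ X, ∀ V : LocalSubring RatFun, q₁ ≤ V → q₂ ≤ V → q₁ = q₂
  generization : ∀ q ∈ X, ∀ V : LocalSubring RatFun, IsLocAt q.toSubring V →
    IsDiscreteValuationRing V.toSubring → V ∈ X

/-- Curves survive a blowup. If V is itself the center, its maximal ideal is generated by a
uniformizer t, and the chart V[𝔪/t] is V again. -/
theorem mem_blowup_of_isDiscreteValuationRing {X : Model} {p V : LocalSubring RatFun}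
    (hV : V ∈ X) [IsDiscreteValuationRing V.toSubring] : V ∈ blowup X p := by
  by_cases h : V = p
  · subst h
    right
    obtain ⟨t, ht⟩ := IsDiscreteValuationRing.exists_irreducible V.toSubring
    have hm := (IsDiscreteValuationRing.irreducible_iff_uniformizer t).1 ht
    have ht0 : (t : RatFun) ≠ 0 := fun e => ht.ne_zero (Subtype.ext e)
    refine ⟨t, coe_mem_vanishingSet_iff.2 ht.not_isUnit, ht0, ?_, le_rfl⟩
    rw [mem_affineModel_iff]
    refine (isLocAt_self V).of_le le_blowupChart (blowupChart_le le_rfl ?_)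
    rintro a ⟨ha, ham⟩
    rw [hm, Ideal.mem_span_singleton] at ham
    obtain ⟨c, hc⟩ := ham
    have hc' : a = t * c := congrArg Subtype.val hc
    have : a / t = c := by rw [hc']; field_simp
    rw [this]
    exact c.2
  · exact Or.inl ⟨hV, h⟩

/-- The ratio t₁/t₂ lies in S₂ and its inverse lies in S₁ ⊆ V. Domination then puts t₂/t₁ in S₂,
which allows the passage from one chart to the other. -/
theorem blowup_point_le_of_le {R S₁ S₂ V : LocalSubring RatFun} {t₁ t₂ : RatFun}
    (ht₁ : t₁ ∈ vanishingSet R) (ht₁0 : t₁ ≠ 0) (ht₂ : t₂ ∈ vanishingSet R) (ht₂0 : t₂ ≠ 0)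
    (h₁ : IsLocAt (blowupChart R t₁) S₁) (h₂ : IsLocAt (blowupChart R t₂) S₂)
    (h₁V : S₁ ≤ V) (h₂V : S₂ ≤ V) : blowupChart R t₁ ≤ S₂.toSubring := by
  have h12 : t₁ / t₂ ∈ S₂.toSubring := h₂.1 (div_mem_blowupChart ht₁)
  have h21 : t₂ / t₁ ∈ S₁.toSubring := h₁.1 (div_mem_blowupChart ht₂)
  have hinv : t₂ / t₁ ∈ S₂.toSubring := by
    have := (localSubring_le_iff.1 h₂V).2 _ h12
    rw [inv_div] at this
    exact this (h₁V.1 h21)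
  refine blowupChart_le (le_blowupChart.trans h₂.1) fun a ha => ?_
  have : a / t₁ = a / t₂ * (t₂ / t₁) := by field_simp
  rw [this]
  exact mul_mem (h₂.1 (div_mem_blowupChart ha)) hinv

theorem IsRegularModel.blowup {X : Model} (hX : IsRegularModel X) {p : LocalSubring RatFun}
    (hp : p ∈ X) : IsRegularModel (blowup X p) := by
  refine ⟨?_, ?_, ?_⟩
  · rintro q (⟨hq, -⟩ | ⟨t, ht, ht0, hq, hpq⟩)
    · exact hX.regular q hq
    · exact (hX.regular p hp).of_blowupChart hpq ht0 ht (mem_affineModel_iff.1 hq)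
  · rintro q₁ (⟨hq₁, hn₁⟩ | ⟨t₁, ht₁, ht₁0, hq₁, hpq₁⟩) q₂
      (⟨hq₂, hn₂⟩ | ⟨t₂, ht₂, ht₂0, hq₂, hpq₂⟩) V h₁ h₂
    · exact hX.separated q₁ hq₁ q₂ hq₂ V h₁ h₂
    · exact absurd (hX.separated q₁ hq₁ p hp V h₁ (hpq₂.trans h₂)) hn₁
    · exact absurd (hX.separated q₂ hq₂ p hp V h₂ (hpq₁.trans h₁)) hn₂
    · rw [mem_affineModel_iff] at hq₁ hq₂
      exact hq₁.eq_of_le hq₂ h₁ h₂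
        (blowup_point_le_of_le ht₁ ht₁0 ht₂ ht₂0 hq₁ hq₂ h₁ h₂)
        (blowup_point_le_of_le ht₂ ht₂0 ht₁ ht₁0 hq₂ hq₁ h₂ h₁)
  · rintro q (⟨hq, -⟩ | ⟨t, ht, ht0, hq, hpq⟩) V hV hdvr
    · exact mem_blowup_of_isDiscreteValuationRing (hX.generization q hq V hV hdvr)
    · have hB := (mem_affineModel_iff.1 hq).trans hV
      -- A curve through a new point that dominates p is again a new point. Otherwise some c ∈ 𝔪_p
      -- is a unit of V, so t⁻¹ = (c/t)c⁻¹ lies in V; where t is invertible the chart adds nothing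
      -- to the local ring of p, so V is a localization of that ring.
      by_cases hpV : p ≤ V
      · exact Or.inr ⟨t, ht, ht0, mem_affineModel_iff.2 hB, hpV⟩
      refine mem_blowup_of_isDiscreteValuationRing (hX.generization p hp V ?_ hdvr)
      have hle : p.toSubring ≤ V.toSubring := hpq.1.trans hV.1
      have hdom := ofPrime_center_le hle
      suffices hVW : V = LocalSubring.ofPrime p.toSubring (center p.toSubring V hle) by
        rw [hVW]; exact isLocAt_ofPrime _ _
      have htV : t⁻¹ ∈ V.toSubring := by
        rw [localSubring_le_iff] at hpV
        push Not at hpV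
        obtain ⟨c, hc, hci, hcn⟩ := hpV hle
        have hc0 : c ≠ 0 := by rintro rfl; simp at hcn
        have hcv : c ∈ vanishingSet p := mem_vanishingSet_iff.2 ⟨hc, fun h => hcn h.2⟩
        have : t⁻¹ = c / t * c⁻¹ := by field_simp
        rw [this]
        exact mul_mem (hB.1 (div_mem_blowupChart hcv)) hci
      refine hB.eq_of_le (isLocAt_ofPrime _ _) le_rfl hdom ?_ hle
      refine blowupChart_le (LocalSubring.le_ofPrime _ _) fun a ha => ?_
      exact mul_mem (LocalSubring.le_ofPrime _ _ ha.1)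
        ((localSubring_le_iff.1 hdom).2 t (LocalSubring.le_ofPrime _ _ ht.1) htV)

end Models

/-! ### Calculus of orders along a discrete valuation ring. -/

section Order

variable {R : LocalSubring RatFun}

theorem hasOrder_zero_iff [IsDiscreteValuationRing R.toSubring] {f : RatFun} :
    HasOrder R f 0 ↔ f ≠ 0 ∧ f ∈ R.toSubring ∧ f⁻¹ ∈ R.toSubring := by
  constructor
  · rintro ⟨ϖ, u, -, rfl⟩
    have := isUnit_subring_iff.1 u.isUnit
    simp only [zpow_zero, mul_one]
    exact ⟨this.1, (u : R.toSubring).2, this.2⟩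
  · rintro ⟨h0, h, hi⟩
    obtain ⟨ϖ, hϖ⟩ := IsDiscreteValuationRing.exists_irreducible R.toSubring
    have hu : IsUnit (⟨f, h⟩ : R.toSubring) := isUnit_subring_iff.2 ⟨h0, hi⟩
    exact ⟨ϖ, hu.unit, hϖ, by simp⟩

theorem hasOrder_one_of_irreducible {ϖ : R.toSubring} (h : Irreducible ϖ) :
    HasOrder R (ϖ : RatFun) 1 :=
  ⟨ϖ, 1, h, by simp⟩

theorem HasOrder.ne_zero {f : RatFun} {n : ℤ} (h : HasOrder R f n) : f ≠ 0 := by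
  obtain ⟨ϖ, u, hϖ, rfl⟩ := h
  have hϖ0 : (ϖ : RatFun) ≠ 0 := fun e => hϖ.ne_zero (Subtype.ext e)
  exact mul_ne_zero (isUnit_subring_iff.1 u.isUnit).1 (zpow_ne_zero _ hϖ0)

theorem hasOrder_iff [IsDiscreteValuationRing R.toSubring] {ϖ : R.toSubring} (hϖ : Irreducible ϖ)
    {f : RatFun} {n : ℤ} :
    HasOrder R f n ↔ ∃ u : (R.toSubring)ˣ, f = ((u : R.toSubring) : RatFun) * (ϖ : RatFun) ^ n := by
  constructor
  · rintro ⟨ϖ', u, hϖ', rfl⟩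
    obtain ⟨v, rfl⟩ := IsDiscreteValuationRing.associated_of_irreducible _ hϖ hϖ'
    have hcoe : (((v ^ n : (R.toSubring)ˣ) : R.toSubring) : RatFun) =
        ((v : R.toSubring) : RatFun) ^ n := by
      have := map_zpow (Units.map (R.toSubring.subtype : R.toSubring →* RatFun)) v n
      have := congrArg Units.val this
      rw [Units.val_zpow_eq_zpow_val] at this
      exact this
    refine ⟨u * v ^ n, ?_⟩
    push_cast
    rw [hcoe, mul_zpow]
    ring
  · rintro ⟨u, rfl⟩
    exact ⟨ϖ, u, hϖ, rfl⟩

variable {f g : RatFun} {m n : ℤ}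

theorem HasOrder.inv (hf : HasOrder R f m) : HasOrder R f⁻¹ (-m) := by
  obtain ⟨ϖ, u, hϖ, rfl⟩ := hf
  refine ⟨ϖ, u⁻¹, hϖ, ?_⟩
  have h : ((u : R.toSubring) : RatFun) * ((u⁻¹ : (R.toSubring)ˣ) : R.toSubring) = 1 := by
    exact_mod_cast congrArg Subtype.val u.mul_inv
  rw [mul_inv, zpow_neg, eq_inv_of_mul_eq_one_right h]

variable [IsDiscreteValuationRing R.toSubring]

theorem HasOrder.mul (hf : HasOrder R f m) (hg : HasOrder R g n) : HasOrder R (f * g) (m + n) := by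
  obtain ⟨ϖ, u, hϖ, rfl⟩ := hf
  obtain ⟨v, rfl⟩ := (hasOrder_iff hϖ).1 hg
  have hϖ0 : (ϖ : RatFun) ≠ 0 := fun e => hϖ.ne_zero (Subtype.ext e)
  refine ⟨ϖ, u * v, hϖ, ?_⟩
  rw [zpow_add₀ hϖ0]
  push_cast
  ring

theorem HasOrder.div (hf : HasOrder R f m) (hg : HasOrder R g n) : HasOrder R (f / g) (m - n) := by
  rw [div_eq_mul_inv, sub_eq_add_neg]
  exact hf.mul hg.inv

theorem hasOrder_one : HasOrder R 1 0 :=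
  hasOrder_zero_iff.2 ⟨one_ne_zero, one_mem _, by simp⟩

theorem HasOrder.pow (hf : HasOrder R f m) (k : ℕ) : HasOrder R (f ^ k) (k * m) := by
  induction k with
  | zero => simpa using hasOrder_one
  | succ k ih =>
    rw [pow_succ]
    convert ih.mul hf using 1
    push_cast; ring

theorem HasOrder.zpow (hf : HasOrder R f m) (k : ℤ) : HasOrder R (f ^ k) (k * m) := by
  cases k with
  | ofNat k => simpa using hf.pow k
  | negSucc k =>
    rw [zpow_negSucc]
    convert (hf.pow (k + 1)).inv using 1
    rw [Int.negSucc_eq]; push_cast; ring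

theorem HasOrder.prod {ι : Type*} (s : Finset ι) {f : ι → RatFun} {n : ι → ℤ}
    (h : ∀ i ∈ s, HasOrder R (f i) (n i)) : HasOrder R (∏ i ∈ s, f i) (∑ i ∈ s, n i) := by
  classical
  induction s using Finset.induction_on with
  | empty => simpa using hasOrder_one
  | insert i s hi ih =>
    rw [Finset.prod_insert hi, Finset.sum_insert hi]
    exact (h i (Finset.mem_insert_self _ _)).mul
      (ih fun j hj => h j (Finset.mem_insert_of_mem hj))

theorem HasOrder.unique (hf : HasOrder R f m) (hf' : HasOrder R f n) : m = n := by
  have key : ∀ k : ℤ, 0 < k → ¬ HasOrder R 1 k := by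
    intro k hk h
    obtain ⟨ϖ, hϖ⟩ := IsDiscreteValuationRing.exists_irreducible R.toSubring
    obtain ⟨u, hu⟩ := (hasOrder_iff hϖ).1 h
    lift k to ℕ using hk.le
    have hu' : (1 : R.toSubring) = u * ϖ ^ k := by
      apply Subtype.ext
      push_cast
      exact_mod_cast hu
    have : IsUnit (ϖ ^ k) := IsUnit.of_mul_eq_one (u : R.toSubring) (by rw [hu', mul_comm])
    exact hϖ.not_isUnit ((isUnit_pow_iff (by omega)).1 this)
  have h1 := hf.div hf'
  have h2 := hf'.div hf
  rw [div_self hf.ne_zero] at h1 h2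
  by_contra hne
  rcases lt_or_gt_of_ne hne with h | h
  · exact key _ (by omega) h2
  · exact key _ (by omega) h1

end Order

/-- On a regular model, a function whose order along every curve through a point is zero is a unit
at that point. -/
theorem IsRegularModel.mem_of_hasOrder_zero {X : Model} (hX : IsRegularModel X)
    {q : LocalSubring RatFun} (hq : q ∈ X) {f : RatFun}
    (h : ∀ Z : PrimeDivisor X, q.toSubring ≤ Z.1.toSubring → HasOrder Z.1 f 0) :
    f ∈ q.toSubring := by
  have hreg := hX.regular q hq
  have := hreg.noetherian
  have := hreg.uniqueFactorizationMonoid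
  refine mem_of_forall_isLocAtElement (hreg.frac f) fun u hu V hV => ?_
  have hdvr := hV.isDiscreteValuationRing hu
  exact (hasOrder_zero_iff.1 (h ⟨V, hX.generization q hq V hV.1 hdvr, hdvr⟩ hV.1.1)).2.1

/-! ### Prime ideals of ℂ[x, y]. -/

section Polynomials

open MvPolynomial

theorem aeval_constant_surjective (a : ℂ) :
    Function.Surjective (aeval ![Polynomial.C a, Polynomial.X] :
      MvPolynomial (Fin 2) ℂ →ₐ[ℂ] Polynomial ℂ) := by
  intro f
  refine ⟨Polynomial.aeval (X 1) f, ?_⟩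
  rw [← Polynomial.aeval_algHom_apply]
  simp

theorem aeval_constant_eq_zero_iff (a : ℂ) (p : MvPolynomial (Fin 2) ℂ) :
    aeval ![Polynomial.C a, Polynomial.X] p = 0 ↔ X 0 - C a ∣ p := by
  constructor
  · intro h
    let I : Ideal (MvPolynomial (Fin 2) ℂ) := Ideal.span {X 0 - C a}
    -- Substituting x = a and then reading the result modulo x − a is just reduction modulo x − a,
    -- so the kernel of the substitution lies in (x − a).
    let ψ : MvPolynomial (Fin 2) ℂ →ₐ[ℂ] MvPolynomial (Fin 2) ℂ ⧸ I :=
      (Ideal.Quotient.mkₐ ℂ I).comp ((Polynomial.aeval (X 1)).comp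
        (aeval ![Polynomial.C a, Polynomial.X]))
    have hψ : ψ = Ideal.Quotient.mkₐ ℂ I := by
      apply MvPolynomial.algHom_ext
      intro i
      fin_cases i
      · simp only [ψ, AlgHom.comp_apply, Ideal.Quotient.mkₐ_eq_mk]
        rw [Eq.comm, Ideal.Quotient.eq]
        simp [I, algebraMap_eq]
      · simp [ψ]
    have h1 : Ideal.Quotient.mkₐ ℂ I p = 0 := by
      rw [← hψ]
      simp [ψ, h]
    rw [Ideal.Quotient.mkₐ_eq_mk, Ideal.Quotient.eq_zero_iff_mem, Ideal.mem_span_singleton] at h1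
    exact h1
  · rintro ⟨q, rfl⟩
    simp

theorem X_sub_C_ne_zero (a : ℂ) : (X 0 - C a : MvPolynomial (Fin 2) ℂ) ≠ 0 := by
  intro h
  have := congrArg (eval (fun _ => a + 1)) h
  simp at this

theorem prime_X_sub_C (a : ℂ) : Prime (X 0 - C a : MvPolynomial (Fin 2) ℂ) :=
  prime_of_surjective
    (aeval ![Polynomial.C a, Polynomial.X] : MvPolynomial (Fin 2) ℂ →ₐ[ℂ] Polynomial ℂ).toRingHom
    (RingHom.id _) Function.surjective_id (X_sub_C_ne_zero a)
    (fun p => aeval_constant_eq_zero_iff a p)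

theorem principalModulo_X_sub_C (a : ℂ) :
    PrincipalModulo (X 0 - C a : MvPolynomial (Fin 2) ℂ) :=
  PrincipalModulo.of_surjective
    (aeval ![Polynomial.C a, Polynomial.X] : MvPolynomial (Fin 2) ℂ →ₐ[ℂ] Polynomial ℂ).toRingHom
    (aeval_constant_surjective a)
    (RingHom.id _) Function.surjective_id (fun p => (aeval_constant_eq_zero_iff a p).1)

/-- The points of the affine plane: the generic point, the curves, and the closed points. -/
theorem prime_ideal_cases (P : Ideal (MvPolynomial (Fin 2) ℂ)) [P.IsPrime] :
    P = ⊥ ∨ (∃ π, Prime π ∧ P = Ideal.span {π}) ∨ ∃ a : ℂ, X 0 - C a ∈ P := by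
  by_cases h0 : P = ⊥
  · exact Or.inl h0
  right
  by_cases hmax : P.IsMaximal
  · right
    -- By the Nullstellensatz, a maximal ideal is the ideal of a point, and a is its first
    -- coordinate.
    obtain ⟨x, hx⟩ := (isMaximal_iff_eq_vanishingIdeal_singleton).1 hmax
    refine ⟨x 0, ?_⟩
    rw [hx, mem_vanishingIdeal_singleton_iff]
    simp
  · left
    obtain ⟨π, hπP, hπ⟩ :=
      UniqueFactorizationMonoid.iff_exists_prime_mem_of_isPrime.mp inferInstance P h0 inferInstance
    refine ⟨π, hπ, ?_⟩
    have hle : Ideal.span {π} ≤ P := (Ideal.span_singleton_le_iff_mem _).2 hπP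
    have hprime : (Ideal.span {π}).IsPrime := (Ideal.span_singleton_prime hπ.ne_zero).2 hπ
    -- Otherwise 0 ⊂ (π) ⊂ P ⊂ M is a chain of primes of length 3 in a ring of dimension 2.
    by_contra hne
    have hlt : Ideal.span {π} < P := lt_of_le_of_ne hle (Ne.symm hne)
    obtain ⟨M, hM, hPM⟩ := Ideal.exists_le_maximal P (Ideal.IsPrime.ne_top inferInstance)
    have hlt' : P < M := lt_of_le_of_ne hPM (fun e => hmax (e ▸ hM))
    have hMp := hM.isPrime
    have hbot : (⊥ : Ideal (MvPolynomial (Fin 2) ℂ)) < Ideal.span {π} :=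
      bot_lt_iff_ne_bot.2 (by rw [Ne, Ideal.span_singleton_eq_bot]; exact hπ.ne_zero)
    have h1 := Ideal.height_add_one_le_of_lt_of_isPrime hbot
    have h2 := Ideal.height_add_one_le_of_lt_of_isPrime hlt
    have h3 := Ideal.height_add_one_le_of_lt_of_isPrime hlt'
    have h4 : (M.height : WithBot ℕ∞) ≤ ringKrullDim (MvPolynomial (Fin 2) ℂ) :=
      Ideal.height_le_ringKrullDim_of_isPrime
    rw [MvPolynomial.ringKrullDim_of_isNoetherianRing, ringKrullDim_eq_zero_of_field] at h4
    have h5 : M.height ≤ 2 := by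
      have : ((0 : WithBot ℕ∞) + (Nat.card (Fin 2) : WithBot ℕ∞)) = ((2 : ℕ∞) : WithBot ℕ∞) := by
        simp
      rw [this] at h4
      exact_mod_cast h4
    have h6 : (3 : ℕ∞) ≤ M.height := by
      refine le_trans ?_ h3
      refine le_trans ?_ (add_le_add_left h2 1)
      refine le_trans ?_ (add_le_add_left (add_le_add_left h1 1) 1)
      rw [Ideal.height_bot]
      norm_num
    exact absurd (h6.trans h5) (by norm_num)

end Polynomials

/-! ### Coordinate charts and the regularity of ℙ¹ × ℙ¹. -/

/-- The coordinate ring `ℂ[u, v]` of a chart. -/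
def coordRing (u v : RatFun) : Subring RatFun := (Algebra.adjoin ℂ {u, v}).toSubring

theorem coordRing_swap (u v : RatFun) : coordRing u v = coordRing v u := by
  rw [coordRing, coordRing, Set.pair_comm]

theorem fst_mem_coordRing (u v : RatFun) : u ∈ coordRing u v :=
  Algebra.subset_adjoin (by simp)

theorem snd_mem_coordRing (u v : RatFun) : v ∈ coordRing u v :=
  Algebra.subset_adjoin (by simp)

theorem algebraMap_mem_coordRing (u v : RatFun) (c : ℂ) : algebraMap ℂ RatFun c ∈ coordRing u v :=
  (Algebra.adjoin ℂ {u, v}).algebraMap_mem c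

theorem coordRing_le {u v : RatFun} {T : Subring RatFun}
    (hc : ∀ c, algebraMap ℂ RatFun c ∈ T) (hu : u ∈ T) (hv : v ∈ T) : coordRing u v ≤ T := by
  intro f hf
  induction (show f ∈ Algebra.adjoin ℂ {u, v} from hf) using Algebra.adjoin_induction with
  | mem x hx =>
    rcases hx with rfl | rfl
    exacts [hu, hv]
  | algebraMap c => exact hc c
  | add x y hx hy h₁ h₂ => exact add_mem (h₁ hx) (h₂ hy)
  | mul x y hx hy h₁ h₂ => exact mul_mem (h₁ hx) (h₂ hy)

/-- `u` and `v` are the coordinates of a chart: they generate the field `ℂ(x, y)`. -/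
def IsCoordPair (u v : RatFun) : Prop :=
  xFun ∈ IntermediateField.adjoin ℂ {u, v} ∧ yFun ∈ IntermediateField.adjoin ℂ {u, v}

theorem polyFun_mem {S : Type*} [SetLike S RatFun] [SubringClass S RatFun] {T : S}
    (hc : ∀ c, algebraMap ℂ RatFun c ∈ T) (hx : xFun ∈ T) (hy : yFun ∈ T)
    (p : MvPolynomial (Fin 2) ℂ) : polyFun p ∈ T := by
  induction p using MvPolynomial.induction_on with
  | C c => exact hc c
  | add p q hp hq => rw [polyFun, map_add]; exact add_mem hp hq
  | mul_X p i hp =>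
    rw [polyFun, map_mul]
    refine mul_mem hp ?_
    fin_cases i
    exacts [hx, hy]

theorem exists_polyFun_div (f : RatFun) : ∃ p q, q ≠ 0 ∧ f = polyFun p * (polyFun q)⁻¹ := by
  obtain ⟨p, q, hq, rfl⟩ := IsFractionRing.div_surjective (A := MvPolynomial (Fin 2) ℂ) f
  exact ⟨p, q, nonZeroDivisors.ne_zero hq, div_eq_mul_inv _ _⟩

theorem polyFun_injective : Function.Injective polyFun :=
  IsFractionRing.injective (MvPolynomial (Fin 2) ℂ) RatFun

namespace IsCoordPair

variable {u v : RatFun}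

theorem frac (h : IsCoordPair u v) (f : RatFun) :
    ∃ a ∈ coordRing u v, ∃ b ∈ coordRing u v, b ≠ 0 ∧ f = a * b⁻¹ := by
  have hf : f ∈ IntermediateField.adjoin ℂ {u, v} := by
    obtain ⟨p, q, -, rfl⟩ := exists_polyFun_div f
    have hp := polyFun_mem (T := IntermediateField.adjoin ℂ {u, v})
      (fun c => IntermediateField.algebraMap_mem _ c) h.1 h.2
    exact mul_mem (hp p) (inv_mem (hp q))
  obtain ⟨r, hr, s, hs, rfl⟩ := IntermediateField.mem_adjoin_iff_div.1 hf
  by_cases hs0 : s = 0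
  · exact ⟨0, zero_mem _, 1, one_mem _, one_ne_zero, by simp [hs0]⟩
  · exact ⟨r, hr, s, hs, hs0, div_eq_mul_inv _ _⟩

/-- The field has transcendence degree at least 2 and is algebraic over ℂ[u, v], so two generators
must form a transcendence basis. -/
theorem algebraicIndependent (h : IsCoordPair u v) : AlgebraicIndependent ℂ ![u, v] := by
  have hrange : Set.range ![u, v] = {u, v} := by simp [Matrix.range_cons, Set.pair_comm]
  have halg : Algebra.IsAlgebraic (Algebra.adjoin ℂ (Set.range ![u, v])) RatFun := by
    rw [hrange]
    refine ⟨fun f => ?_⟩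
    obtain ⟨a, ha, b, hb, hb0, rfl⟩ := h.frac f
    have ha' : IsAlgebraic (Algebra.adjoin ℂ {u, v}) a :=
      isAlgebraic_algebraMap (⟨a, ha⟩ : Algebra.adjoin ℂ {u, v})
    have hb' : IsAlgebraic (Algebra.adjoin ℂ {u, v}) b :=
      isAlgebraic_algebraMap (⟨b, hb⟩ : Algebra.adjoin ℂ {u, v})
    exact ha'.mul hb'.inv
  refine (Algebra.IsAlgebraic.isTranscendenceBasis_of_le_trdeg_of_finite ℂ ![u, v] ?_).1
  have hle := _root_.trdeg_le_of_injective
    (IsScalarTower.toAlgHom ℂ (MvPolynomial (Fin 2) ℂ) RatFun) polyFun_injective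
  rw [MvPolynomial.trdeg_of_isDomain] at hle
  simpa using hle

/-- The identification of `ℂ[u, v]` with the polynomial ring. -/
def hom (u v : RatFun) : MvPolynomial (Fin 2) ℂ →+* coordRing u v :=
  (MvPolynomial.aeval ![u, v] : MvPolynomial (Fin 2) ℂ →ₐ[ℂ] RatFun).toRingHom.codRestrict
    (coordRing u v) (by
      intro p
      change _ ∈ Algebra.adjoin ℂ {u, v}
      have hrange : Set.range ![u, v] = {u, v} := by simp [Matrix.range_cons, Set.pair_comm]
      rw [← hrange, Algebra.adjoin_range_eq_range_aeval]
      exact ⟨p, rfl⟩)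

theorem coe_hom (p : MvPolynomial (Fin 2) ℂ) :
    (hom u v p : RatFun) = MvPolynomial.aeval ![u, v] p := rfl

theorem hom_bijective (h : IsCoordPair u v) : Function.Bijective (hom u v) := by
  constructor
  · intro p q hpq
    exact h.algebraicIndependent (congrArg Subtype.val hpq)
  · rintro ⟨f, hf⟩
    have hrange : Set.range ![u, v] = {u, v} := by simp [Matrix.range_cons, Set.pair_comm]
    have hf' : f ∈ Algebra.adjoin ℂ (Set.range ![u, v]) := by rw [hrange]; exact hf
    rw [Algebra.adjoin_range_eq_range_aeval] at hf'
    obtain ⟨p, hp⟩ := hf'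
    exact ⟨p, Subtype.ext hp⟩

/-- The identification of `ℂ[u, v]` with the polynomial ring, as an isomorphism. -/
def equiv (h : IsCoordPair u v) : MvPolynomial (Fin 2) ℂ ≃+* coordRing u v :=
  RingEquiv.ofBijective (hom u v) h.hom_bijective

theorem isNoetherianRing (h : IsCoordPair u v) : IsNoetherianRing (coordRing u v) :=
  isNoetherianRing_of_ringEquiv _ h.equiv

theorem uniqueFactorizationMonoid (h : IsCoordPair u v) :
    UniqueFactorizationMonoid (coordRing u v) :=
  (MulEquiv.uniqueFactorizationMonoid_iff h.equiv.toMulEquiv).1 inferInstance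

/-- The line `u = a` in the chart. -/
def line (u v : RatFun) (a : ℂ) : coordRing u v :=
  ⟨u - algebraMap ℂ RatFun a,
    sub_mem (fst_mem_coordRing u v) (algebraMap_mem_coordRing u v a)⟩

theorem hom_X_sub_C (a : ℂ) : hom u v (MvPolynomial.X 0 - MvPolynomial.C a) = line u v a := by
  apply Subtype.ext
  simp [coe_hom, line]

theorem prime_line (h : IsCoordPair u v) (a : ℂ) : Prime (line u v a) := by
  rw [← hom_X_sub_C]
  exact (MulEquiv.prime_iff h.equiv.toMulEquiv).2 (prime_X_sub_C a)

theorem principalModulo_line (h : IsCoordPair u v) (a : ℂ) : PrincipalModulo (line u v a) := by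
  intro I hI
  obtain ⟨g, hg⟩ := principalModulo_X_sub_C a (I.comap (hom u v)) (by
    rw [Ideal.mem_comap, hom_X_sub_C]; exact hI)
  refine ⟨hom u v g, ?_⟩
  rw [← Ideal.map_comap_of_surjective _ h.hom_bijective.2 I, hg, Ideal.map_span,
    Set.image_pair, hom_X_sub_C]

/-- The center on the chart is the generic point, a curve, or contains some u − a. These give
respectively a field, a discrete valuation ring with its uniformizer, and the prime element u − a
with quotient ℂ[v]. -/
theorem isRegularPoint (h : IsCoordPair u v) {V : LocalSubring RatFun}
    (hV : IsLocAt (coordRing u v) V) : IsRegularPoint V := by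
  have := h.isNoetherianRing
  have := hV.isNoetherianRing
  refine ⟨this, fun f => ?_, ?_⟩
  · obtain ⟨a, ha, b, hb, hf⟩ := h.frac f
    exact ⟨a, hV.1 ha, b, hV.1 hb, hf⟩
  rcases prime_ideal_cases ((center _ V hV.1).comap (hom u v)) with h0 | ⟨π, hπ, hP⟩ | ⟨a, ha⟩
  · left
    intro f hf
    obtain ⟨a, ha, s, hs, hs0, hsi, rfl⟩ := hV.2 f hf
    by_cases ha0 : a = 0
    · simp [ha0]
    rw [mul_inv, inv_inv]
    refine mul_mem ?_ (hV.1 hs)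
    by_contra hai
    have hac : (⟨a, ha⟩ : coordRing u v) ∈ center _ V hV.1 :=
      (mem_center_iff hV.1).2 fun h => hai h.2
    obtain ⟨p, hp⟩ := h.hom_bijective.2 ⟨a, ha⟩
    have hp0 : p ∈ (center _ V hV.1).comap (hom u v) := by
      rw [Ideal.mem_comap, hp]; exact hac
    rw [h0, Ideal.mem_bot] at hp0
    rw [hp0, map_zero] at hp
    exact ha0 (congrArg Subtype.val hp).symm
  · right
    have hπ' : Prime (hom u v π) := (MulEquiv.prime_iff h.equiv.toMulEquiv).2 hπ
    have hloc : IsLocAtElement (coordRing u v) (hom u v π) V := by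
      refine ⟨hV, fun b => ?_⟩
      obtain ⟨p, rfl⟩ := h.hom_bijective.2 b
      rw [← not_iff_not, ← mem_center_iff hV.1, not_not, ← Ideal.mem_comap, hP,
        Ideal.mem_span_singleton]
      exact (map_dvd_iff h.equiv).symm
    have hdvr := hloc.isDiscreteValuationRing hπ'
    refine ⟨_, hloc.irreducible.prime, fun I hI => ?_⟩
    by_cases hItop : I = ⊤
    · refine ⟨1, ?_⟩
      rw [hItop, Eq.comm, Ideal.eq_top_iff_one]
      exact Ideal.subset_span (by simp)
    · refine ⟨0, le_antisymm ?_ ?_⟩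
      · refine (IsLocalRing.le_maximalIdeal hItop).trans ?_
        rw [hloc.maximalIdeal_eq]
        exact Ideal.span_mono (by simp)
      · rw [Ideal.span_le]
        rintro x (rfl | rfl)
        exacts [hI, I.zero_mem]
  · right
    rw [Ideal.mem_comap, hom_X_sub_C, mem_center_iff] at ha
    refine ⟨_, hV.prime (h.prime_line a) ?_, hV.principalModulo (h.principalModulo_line a)⟩
    intro hi
    refine ha ⟨?_, hi⟩
    exact fun e => (h.prime_line a).ne_zero (Subtype.ext e)

end IsCoordPair

theorem isCoordPair_of_mem {u v : RatFun} (hu : u ∈ ({xFun, xFun⁻¹} : Set RatFun))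
    (hv : v ∈ ({yFun, yFun⁻¹} : Set RatFun)) : IsCoordPair u v := by
  have h1 : u ∈ IntermediateField.adjoin ℂ {u, v} := IntermediateField.subset_adjoin _ _ (by simp)
  have h2 : v ∈ IntermediateField.adjoin ℂ {u, v} := IntermediateField.subset_adjoin _ _ (by simp)
  constructor
  · rcases hu with rfl | rfl
    · exact h1
    · simpa using inv_mem h1
  · rcases hv with rfl | rfl
    · exact h2
    · simpa using inv_mem h2

theorem mem_P1P1_iff {R : LocalSubring RatFun} :
    R ∈ P1P1 ↔ ∃ u ∈ ({xFun, xFun⁻¹} : Set RatFun), ∃ v ∈ ({yFun, yFun⁻¹} : Set RatFun),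
      IsLocAt (coordRing u v) R := by
  simp only [P1P1, Set.mem_ofPred_eq, mem_affineModel_iff]
  rfl

theorem coordinate_mem_of_le {q V : LocalSubring RatFun} (h : q ≤ V) {c u u' : RatFun}
    (hu : u ∈ ({c, c⁻¹} : Set RatFun)) (hu' : u' ∈ ({c, c⁻¹} : Set RatFun))
    (huq : u ∈ q.toSubring) (hu'V : u' ∈ V.toSubring) : u' ∈ q.toSubring := by
  have h' := (localSubring_le_iff.1 h).2 u huq
  rcases hu with rfl | rfl <;> rcases hu' with rfl | rfl
  · exact huq
  · exact h' hu'V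
  · rw [inv_inv] at h'; exact h' hu'V
  · exact huq

theorem isRegularModel_P1P1 : IsRegularModel P1P1 := by
  refine ⟨?_, ?_, ?_⟩
  · intro q hq
    obtain ⟨u, hu, v, hv, h⟩ := mem_P1P1_iff.1 hq
    exact (isCoordPair_of_mem hu hv).isRegularPoint h
  · intro q₁ hq₁ q₂ hq₂ V h₁ h₂
    obtain ⟨u₁, hu₁, v₁, hv₁, hl₁⟩ := mem_P1P1_iff.1 hq₁
    obtain ⟨u₂, hu₂, v₂, hv₂, hl₂⟩ := mem_P1P1_iff.1 hq₂
    refine hl₁.eq_of_le hl₂ h₁ h₂ ?_ ?_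
    · exact coordRing_le (fun c => hl₂.1 (algebraMap_mem_coordRing _ _ c))
        (coordinate_mem_of_le h₂ hu₂ hu₁ (hl₂.1 (fst_mem_coordRing _ _))
          (h₁.1 (hl₁.1 (fst_mem_coordRing _ _))))
        (coordinate_mem_of_le h₂ hv₂ hv₁ (hl₂.1 (snd_mem_coordRing _ _))
          (h₁.1 (hl₁.1 (snd_mem_coordRing _ _))))
    · exact coordRing_le (fun c => hl₁.1 (algebraMap_mem_coordRing _ _ c))
        (coordinate_mem_of_le h₁ hu₁ hu₂ (hl₁.1 (fst_mem_coordRing _ _))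
          (h₂.1 (hl₂.1 (fst_mem_coordRing _ _))))
        (coordinate_mem_of_le h₁ hv₁ hv₂ (hl₁.1 (snd_mem_coordRing _ _))
          (h₂.1 (hl₂.1 (snd_mem_coordRing _ _))))
  · intro q hq V hV _
    obtain ⟨u, hu, v, hv, h⟩ := mem_P1P1_iff.1 hq
    exact mem_P1P1_iff.2 ⟨u, hu, v, hv, h.trans hV⟩

theorem IsBlownUpSurface.isRegularModel {X : Model} (hX : IsBlownUpSurface X) :
    IsRegularModel X := by
  induction hX with
  | base => exact isRegularModel_P1P1
  | step X p _ hp _ ih => exact ih.blowup hp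

theorem IsBlownUpSurface.mem_of_mem_P1P1 {X : Model} (hX : IsBlownUpSurface X)
    {V : LocalSubring RatFun} (hV : V ∈ P1P1) [IsDiscreteValuationRing V.toSubring] : V ∈ X := by
  induction hX with
  | base => exact hV
  | step X p _ hp _ ih => exact mem_blowup_of_isDiscreteValuationRing ih

section LocalizationAtPrimeElement

variable {K : Type*} [Field K] {A : Subring K} {V W : LocalSubring K} {u : A}

theorem IsLocAtElement.le (hV : IsLocAtElement A u V) (hW : IsLocAtElement A u W) :
    V.toSubring ≤ W.toSubring := by
  intro f hf
  obtain ⟨a, ha, s, hs, hs0, hsi, rfl⟩ := hV.1.2 f hf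
  exact mul_mem (hW.1.1 ha) ((hW.2 ⟨s, hs⟩).2 ((hV.2 ⟨s, hs⟩).1 ⟨hs0, hsi⟩)).2

theorem IsLocAtElement.unique (hV : IsLocAtElement A u V) (hW : IsLocAtElement A u W) : V = W :=
  LocalSubring.toSubring_injective (le_antisymm (hV.le hW) (hW.le hV))

/-- The element u remains prime in V, so it is a uniformizer. If b vanishes along V, then u divides
bs for a denominator s that is a unit of V; such an s is not divisible by u, so u divides b. -/
theorem IsLocAt.isLocAtElement [IsDiscreteValuationRing V.toSubring] (hV : IsLocAt A V)
    (hu : Prime u) (hn : (u : K)⁻¹ ∉ V.toSubring) : IsLocAtElement A u V := by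
  refine ⟨hV, fun b => ⟨?_, ?_⟩⟩
  · rintro ⟨hb0, hbi⟩ ⟨c, rfl⟩
    apply hn
    push_cast at hb0 hbi
    have hc0 := right_ne_zero_of_mul hb0
    have : (u : K)⁻¹ = (u * c : K)⁻¹ * c := by field_simp
    rw [this]
    exact mul_mem hbi (hV.1 c.2)
  · intro hub
    by_contra hb
    have hirr : Irreducible (Subring.inclusion hV.1 u) := (hV.prime hu hn).irreducible
    have hm := (IsDiscreteValuationRing.irreducible_iff_uniformizer _).1 hirr
    have hbm : Subring.inclusion hV.1 b ∈ IsLocalRing.maximalIdeal V.toSubring := by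
      rw [IsLocalRing.mem_maximalIdeal, mem_nonunits_iff, isUnit_subring_iff]
      exact hb
    rw [hm, Ideal.mem_span_singleton] at hbm
    obtain ⟨⟨f, hf⟩, hbf⟩ := hbm
    have hbf' : (b : K) = u * f := congrArg Subtype.val hbf
    obtain ⟨r, hr, s, hs, hs0, hsi, rfl⟩ := hV.2 f hf
    have hdvd : u ∣ b * ⟨s, hs⟩ := by
      refine ⟨⟨r, hr⟩, Subtype.ext ?_⟩
      change (b : K) * s = u * r
      rw [hbf']; field_simp
    rcases hu.dvd_or_dvd hdvd with h | ⟨c, hc⟩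
    · exact hub h
    · apply hn
      have hc' : s = u * c := congrArg Subtype.val hc
      have hc0 : (c : K) ≠ 0 := right_ne_zero_of_mul (hc' ▸ hs0)
      have hu0 : (u : K) ≠ 0 := left_ne_zero_of_mul (hc' ▸ hs0)
      have : (u : K)⁻¹ = s⁻¹ * c := by rw [hc']; field_simp
      rw [this]
      exact mul_mem hsi (hV.1 c.2)

end LocalizationAtPrimeElement

/-! ### Coordinate lines and the divisors of linear forms. -/

theorem coordinate_mem {Z : LocalSubring RatFun} (hZ : Z ∈ P1P1) :
    (xFun ∈ Z.toSubring ∨ xFun⁻¹ ∈ Z.toSubring) ∧ (yFun ∈ Z.toSubring ∨ yFun⁻¹ ∈ Z.toSubring) := by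
  obtain ⟨u, hu, v, hv, h⟩ := mem_P1P1_iff.1 hZ
  have h1 := h.1 (fst_mem_coordRing u v)
  have h2 := h.1 (snd_mem_coordRing u v)
  constructor
  · rcases hu with rfl | rfl
    exacts [Or.inl h1, Or.inr h1]
  · rcases hv with rfl | rfl
    exacts [Or.inl h2, Or.inr h2]

theorem algebraMap_mem {Z : LocalSubring RatFun} (hZ : Z ∈ P1P1) (c : ℂ) :
    algebraMap ℂ RatFun c ∈ Z.toSubring := by
  obtain ⟨u, hu, v, hv, h⟩ := mem_P1P1_iff.1 hZ
  exact h.1 (algebraMap_mem_coordRing u v c)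

/-- The center of Z on the given chart is a point of ℙ¹ × ℙ¹ dominated by Z, hence equals Z by
separatedness. A point can thus be read in any chart whose coordinates are regular there. -/
theorem isLocAt_coordRing {Z : LocalSubring RatFun} (hZ : Z ∈ P1P1) {u v : RatFun}
    (hu : u ∈ ({xFun, xFun⁻¹} : Set RatFun)) (hv : v ∈ ({yFun, yFun⁻¹} : Set RatFun))
    (huZ : u ∈ Z.toSubring) (hvZ : v ∈ Z.toSubring) : IsLocAt (coordRing u v) Z := by
  have hle : coordRing u v ≤ Z.toSubring := coordRing_le (algebraMap_mem hZ) huZ hvZ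
  suffices h : Z = LocalSubring.ofPrime (coordRing u v) (center _ Z hle) by
    rw [h]; exact isLocAt_ofPrime _ _
  exact isRegularModel_P1P1.separated _ hZ _
    (mem_P1P1_iff.2 ⟨u, hu, v, hv, isLocAt_ofPrime _ _⟩) Z le_rfl (ofPrime_center_le hle)

/-- `c` is an affine coordinate on one of the factors of `ℙ¹ × ℙ¹`, and `d` is one on the other. -/
structure IsCoordSystem (c d : RatFun) : Prop where
  pair : IsCoordPair c d
  pair_inv : IsCoordPair c d⁻¹
  mem : ∀ Z ∈ P1P1, d ∈ Z.toSubring ∨ d⁻¹ ∈ Z.toSubring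
  isLocAt : ∀ Z ∈ P1P1, c ∈ Z.toSubring → d ∈ Z.toSubring → IsLocAt (coordRing c d) Z
  isLocAt_inv : ∀ Z ∈ P1P1, c ∈ Z.toSubring → d⁻¹ ∈ Z.toSubring → IsLocAt (coordRing c d⁻¹) Z

theorem isCoordPair_swap {u v : RatFun} (h : IsCoordPair u v) : IsCoordPair v u := by
  rw [IsCoordPair, Set.pair_comm]; exact h

theorem isCoordSystem_x {u : RatFun} (hu : u ∈ ({xFun, xFun⁻¹} : Set RatFun)) :
    IsCoordSystem u yFun where
  pair := isCoordPair_of_mem hu (by simp)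
  pair_inv := isCoordPair_of_mem hu (by simp)
  mem _ hZ := (coordinate_mem hZ).2
  isLocAt _ hZ := isLocAt_coordRing hZ hu (by simp)
  isLocAt_inv _ hZ := isLocAt_coordRing hZ hu (by simp)

theorem isCoordSystem_y {v : RatFun} (hv : v ∈ ({yFun, yFun⁻¹} : Set RatFun)) :
    IsCoordSystem v xFun where
  pair := isCoordPair_swap (isCoordPair_of_mem (by simp) hv)
  pair_inv := isCoordPair_swap (isCoordPair_of_mem (by simp) hv)
  mem _ hZ := (coordinate_mem hZ).1
  isLocAt _ hZ h1 h2 := by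
    rw [coordRing_swap]; exact isLocAt_coordRing hZ (by simp) hv h2 h1
  isLocAt_inv _ hZ h1 h2 := by
    rw [coordRing_swap]; exact isLocAt_coordRing hZ (by simp) hv h2 h1

namespace IsCoordPair

variable {c d : RatFun}

theorem sub_ne_zero (h : IsCoordPair c d) (a : ℂ) : c - algebraMap ℂ RatFun a ≠ 0 :=
  fun e => (h.prime_line a).ne_zero (Subtype.ext e)

theorem not_line_dvd_snd (h : IsCoordPair c d) (a : ℂ) :
    ¬ line c d a ∣ ⟨d, snd_mem_coordRing c d⟩ := by
  have hd : (⟨d, snd_mem_coordRing c d⟩ : coordRing c d) = hom c d (MvPolynomial.X 1) := by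
    apply Subtype.ext
    simp [coe_hom]
  rw [hd, ← hom_X_sub_C]
  intro hdvd
  have := (map_dvd_iff h.equiv).1 hdvd
  rw [← aeval_constant_eq_zero_iff] at this
  simp at this

theorem isLocAtElement_line (h : IsCoordPair c d) {a : ℂ} {Z : LocalSubring RatFun}
    [IsDiscreteValuationRing Z.toSubring] (hZ : IsLocAt (coordRing c d) Z)
    (ha : c - algebraMap ℂ RatFun a ∈ vanishingSet Z) :
    IsLocAtElement (coordRing c d) (line c d a) Z :=
  hZ.isLocAtElement (h.prime_line a) fun hi =>
    (mem_vanishingSet_iff.1 ha).2 ⟨h.sub_ne_zero a, hi⟩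

theorem inv_snd_mem (h : IsCoordPair c d) {a : ℂ} {Z : LocalSubring RatFun}
    [IsDiscreteValuationRing Z.toSubring] (hZ : IsLocAt (coordRing c d) Z)
    (ha : c - algebraMap ℂ RatFun a ∈ vanishingSet Z) : d⁻¹ ∈ Z.toSubring :=
  (((h.isLocAtElement_line hZ ha).2 _).2 (h.not_line_dvd_snd a)).2

end IsCoordPair

namespace IsCoordSystem

variable {c d : RatFun}

theorem fst_mem {a : ℂ} {Z : LocalSubring RatFun} (hZ : Z ∈ P1P1)
    (ha : c - algebraMap ℂ RatFun a ∈ vanishingSet Z) : c ∈ Z.toSubring := by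
  have := add_mem ha.1 (algebraMap_mem hZ a)
  rwa [sub_add_cancel] at this

theorem isLocAtElement_line (h : IsCoordSystem c d) {a : ℂ} {Z : LocalSubring RatFun}
    [IsDiscreteValuationRing Z.toSubring] (hZ : Z ∈ P1P1)
    (ha : c - algebraMap ℂ RatFun a ∈ vanishingSet Z) :
    IsLocAtElement (coordRing c d) (IsCoordPair.line c d a) Z := by
  have hc := fst_mem hZ ha
  refine h.pair.isLocAtElement_line (h.isLocAt Z hZ hc ?_) ha
  rcases h.mem Z hZ with hd | hd
  · exact hd
  -- If only d⁻¹ is known to be regular, it is still not divisible by c − a, so it is a unit along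
  -- the line and d is regular after all.
  · have := h.pair_inv.inv_snd_mem (h.isLocAt_inv Z hZ hc hd) ha
    rwa [inv_inv] at this

theorem eq_of_sub_mem (h : IsCoordSystem c d) {a : ℂ} {Z W : PrimeDivisor P1P1}
    (hZ : c - algebraMap ℂ RatFun a ∈ vanishingSet Z.1)
    (hW : c - algebraMap ℂ RatFun a ∈ vanishingSet W.1) : Z = W := by
  have := Z.2.2
  have := W.2.2
  exact Subtype.ext ((h.isLocAtElement_line Z.2.1 hZ).unique (h.isLocAtElement_line W.2.1 hW))

theorem hasOrder_line (h : IsCoordSystem c d) {a : ℂ} {Z : PrimeDivisor P1P1}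
    (hZ : c - algebraMap ℂ RatFun a ∈ vanishingSet Z.1) :
    HasOrder Z.1 (c - algebraMap ℂ RatFun a) 1 := by
  have := Z.2.2
  exact hasOrder_one_of_irreducible (h.isLocAtElement_line Z.2.1 hZ).irreducible

end IsCoordSystem

theorem linForm_infty (c : RatFun) : linForm OnePoint.infty c = 1 := rfl

theorem linForm_coe (c : RatFun) (b : ℂ) :
    linForm (b : OnePoint ℂ) c = c - algebraMap ℂ RatFun b := rfl

theorem hasValue_infty_iff {R : LocalSubring RatFun} {c : RatFun} :
    HasValue R c OnePoint.infty ↔ c⁻¹ ∈ vanishingSet R := Iff.rfl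

theorem hasValue_coe_iff {R : LocalSubring RatFun} {c : RatFun} {b : ℂ} :
    HasValue R c (b : OnePoint ℂ) ↔ c - algebraMap ℂ RatFun b ∈ vanishingSet R := Iff.rfl

theorem inv_mem_of_notMem_vanishingSet {R : LocalSubring RatFun} {a : RatFun}
    (ha : a ∈ R.toSubring) (h : a ∉ vanishingSet R) : a ≠ 0 ∧ a⁻¹ ∈ R.toSubring := by
  by_contra hn
  exact h (mem_vanishingSet_iff.2 ⟨ha, hn⟩)

/-- The divisors of the linear forms in a coordinate `c` differ from the corresponding coordinate
lines by a common divisor. -/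
theorem exists_hasOrder_linForm {c d : RatFun} (h : IsCoordSystem c d)
    (h' : IsCoordSystem c⁻¹ d) (hc : ∀ Z ∈ P1P1, c ∈ Z.toSubring ∨ c⁻¹ ∈ Z.toSubring)
    (Z : PrimeDivisor P1P1) : ∃ s : ℤ, ∀ (a : OnePoint ℂ) (W : PrimeDivisor P1P1),
      HasValue W.1 c a → HasOrder Z.1 (linForm a c) ((Finsupp.single W 1 : WeilDiv P1P1) Z + s) := by
  have := Z.2.2
  have hc0 : c ≠ 0 := by simpa using h.pair.sub_ne_zero 0
  by_cases hcZ : c ∈ Z.1.toSubring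
  -- Away from c = ∞ no correction is needed.
  · refine ⟨0, fun a W hW => ?_⟩
    rw [add_zero]
    induction a using OnePoint.rec with
    | infty =>
      rw [hasValue_infty_iff, mem_vanishingSet_iff] at hW
      have hne : W ≠ Z := by
        rintro rfl
        exact hW.2 ⟨inv_ne_zero hc0, by rwa [inv_inv]⟩
      rw [linForm_infty, Finsupp.single_eq_of_ne' hne]
      exact hasOrder_one
    | coe b =>
      rw [hasValue_coe_iff] at hW
      rw [linForm_coe]
      by_cases hb : c - algebraMap ℂ RatFun b ∈ vanishingSet Z.1
      · rw [h.eq_of_sub_mem hW hb, Finsupp.single_eq_same]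
        exact h.hasOrder_line hb
      · have hne : W ≠ Z := by rintro rfl; exact hb hW
        rw [Finsupp.single_eq_of_ne' hne, hasOrder_zero_iff]
        have hmem := sub_mem hcZ (algebraMap_mem Z.2.1 b)
        have := inv_mem_of_notMem_vanishingSet hmem hb
        exact ⟨this.1, hmem, this.2⟩
  · have hciZ : c⁻¹ ∈ vanishingSet Z.1 := by
      refine mem_vanishingSet_iff.2 ⟨(hc Z.1 Z.2.1).resolve_left hcZ, fun hi => hcZ ?_⟩
      simpa using hi.2
    have hci0 : c⁻¹ - algebraMap ℂ RatFun 0 ∈ vanishingSet Z.1 := by simpa using hciZ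
    have hord : HasOrder Z.1 c (-1) := by
      have := (h'.hasOrder_line hci0).inv
      simpa using this
    -- Along c = ∞ the form 1 has order 0 = 1 − 1, and c − b = c(1 − b/c) has order −1.
    refine ⟨-1, fun a W hW => ?_⟩
    induction a using OnePoint.rec with
    | infty =>
      rw [hasValue_infty_iff] at hW
      have hW0 : c⁻¹ - algebraMap ℂ RatFun 0 ∈ vanishingSet W.1 := by simpa using hW
      rw [linForm_infty, h'.eq_of_sub_mem hW0 hci0, Finsupp.single_eq_same]
      exact hasOrder_one
    | coe b =>
      rw [hasValue_coe_iff] at hW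
      have hne : W ≠ Z := by
        rintro rfl
        exact hcZ (IsCoordSystem.fst_mem W.2.1 hW)
      have hbm : c⁻¹ * algebraMap ℂ RatFun b ∈ vanishingSet Z.1 :=
        mul_mem_vanishingSet hciZ (algebraMap_mem Z.2.1 b)
      have hmem : 1 - c⁻¹ * algebraMap ℂ RatFun b ∈ Z.1.toSubring := sub_mem (one_mem _) hbm.1
      have hunit := inv_mem_of_notMem_vanishingSet hmem (fun hv =>
        one_notMem_vanishingSet (by simpa using add_mem_vanishingSet hv hbm))
      have h0 : HasOrder Z.1 (1 - c⁻¹ * algebraMap ℂ RatFun b) 0 :=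
        hasOrder_zero_iff.2 ⟨hunit.1, hmem, hunit.2⟩
      rw [linForm_coe, Finsupp.single_eq_of_ne' hne]
      convert hord.mul h0 using 1
      · field_simp
      · ring

/-! ### Pull-back of divisors under rational maps. -/

/-- The preimage of a local subring under a homomorphism of fields. -/
def comapLocalSubring {K L : Type*} [Field K] [Field L] (φ : K →+* L) (R : LocalSubring L) :
    LocalSubring K where
  toSubring := R.toSubring.comap φ
  isLocalRing := by
    let f : R.toSubring.comap φ →+* R.toSubring :=
      (φ.comp (R.toSubring.comap φ).subtype).codRestrict R.toSubring fun a => a.2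
    have : IsLocalHom f := by
      refine ⟨fun a ha => ?_⟩
      have h := isUnit_subring_iff.1 ha
      refine isUnit_subring_iff.2 ⟨fun e => h.1 ?_, ?_⟩
      · change φ a = 0
        rw [e, map_zero]
      · change φ _ ∈ R.toSubring
        rw [map_inv₀]
        exact h.2
    exact f.domain_isLocalRing

variable {φ : RatFun →ₐ[ℂ] RatFun} {R q : LocalSubring RatFun}

theorem MapsTo.mem (h : MapsTo φ R q) {a : RatFun} (ha : a ∈ q.toSubring) :
    φ a ∈ R.toSubring :=
  h.1 ⟨a, ha, rfl⟩

/-- All images of R are dominated by the single local ring φ⁻¹(R), so separatedness of the target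
makes the image unique. -/
theorem MapsTo.le_comap (h : MapsTo φ R q) :
    q ≤ comapLocalSubring (φ : RatFun →+* RatFun) R := by
  refine localSubring_le_iff.2 ⟨fun a ha => h.mem ha, fun a ha hi => ?_⟩
  have hi' : (φ a)⁻¹ ∈ R.toSubring := by rw [← map_inv₀]; exact hi
  obtain ⟨b, hb, hb'⟩ := (localSubring_le_iff.1 h).2 (φ a) ⟨a, ha, rfl⟩ hi'
  have : φ b = φ a⁻¹ := by rw [map_inv₀]; exact hb'
  rwa [← φ.injective this]

/-- On a regular model, a dominant rational map sends a point to at most one point. -/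
theorem IsRegularModel.eq_of_mapsTo {Y : Model} (hY : IsRegularModel Y)
    {q₁ q₂ : LocalSubring RatFun} (h₁ : q₁ ∈ Y) (h₂ : q₂ ∈ Y) (hm₁ : MapsTo φ R q₁)
    (hm₂ : MapsTo φ R q₂) : q₁ = q₂ :=
  hY.separated q₁ h₁ q₂ h₂ _ hm₁.le_comap hm₂.le_comap

/-- Two functions with the same orders along all curves through the image of the generic point of a
curve `R` have pull-backs of the same order along `R`. -/
theorem IsRegularModel.hasOrder_map {Y : Model} (hY : IsRegularModel Y)
    [IsDiscreteValuationRing R.toSubring] (hq : q ∈ Y) (hm : MapsTo φ R q) {F G : RatFun}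
    {n : PrimeDivisor Y → ℤ} {k : ℤ} (hF0 : F ≠ 0)
    (hF : ∀ Z : PrimeDivisor Y, q.toSubring ≤ Z.1.toSubring → HasOrder Z.1 F (n Z))
    (hG : ∀ Z : PrimeDivisor Y, q.toSubring ≤ Z.1.toSubring → HasOrder Z.1 G (n Z))
    (hk : HasOrder R (φ G) k) : HasOrder R (φ F) k := by
  have hG0 : G ≠ 0 := by
    rintro rfl
    exact hk.ne_zero (map_zero φ)
  have h1 : F / G ∈ q.toSubring := hY.mem_of_hasOrder_zero hq fun Z hZ => by
    have := Z.2.2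
    simpa using (hF Z hZ).div (hG Z hZ)
  have h2 : G / F ∈ q.toSubring := hY.mem_of_hasOrder_zero hq fun Z hZ => by
    have := Z.2.2
    simpa using (hG Z hZ).div (hF Z hZ)
  have h0 : HasOrder R (φ (F / G)) 0 := by
    refine hasOrder_zero_iff.2 ⟨?_, hm.mem h1, ?_⟩
    · rw [map_ne_zero]; exact div_ne_zero hF0 hG0
    · rw [← map_inv₀, inv_div]; exact hm.mem h2
  have h3 := h0.mul hk
  rw [← map_mul, div_mul_cancel₀ _ hG0, zero_add] at h3
  exact h3

/-- The divisor of a function is compatible with pull-back under a birational morphism. -/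
theorem hasOrder_of_isPullback_id {X Y : Model} (hY : IsRegularModel Y)
    {F : RatFun} {D₁ D₂ : WeilDiv Y} {A₁ A₂ : WeilDiv X} (hF0 : F ≠ 0)
    (hF : ∀ Z : PrimeDivisor Y, HasOrder Z.1 F (D₁ Z - D₂ Z))
    (h₁ : IsPullback (AlgHom.id ℂ RatFun) D₁ A₁) (h₂ : IsPullback (AlgHom.id ℂ RatFun) D₂ A₂)
    (Z : PrimeDivisor X) : HasOrder Z.1 F (A₁ Z - A₂ Z) := by
  have := Z.2.2
  obtain ⟨q₁, hq₁, hm₁, g₁, hg₁, ho₁⟩ := h₁ Z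
  obtain ⟨q₂, hq₂, hm₂, g₂, hg₂, ho₂⟩ := h₂ Z
  obtain rfl := hY.eq_of_mapsTo hq₁ hq₂ hm₁ hm₂
  refine hY.hasOrder_map (φ := AlgHom.id ℂ RatFun) (G := g₁ / g₂) hq₁ hm₁ hF0
    (fun W _ => hF W) (fun W hW => ?_) (ho₁.div ho₂)
  have := W.2.2
  exact (hg₁.2 W hW).div (hg₂.2 W hW)

/-- The order of `φ F` along a curve, in terms of the pull-backs of the components of the divisor
of `F`. -/
theorem hasOrder_map_of_isPullback {X Y : Model} (hY : IsRegularModel Y) {F : RatFun}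
    {A₁ A₂ : WeilDiv Y} {B : PrimeDivisor Y → WeilDiv X} (hF0 : F ≠ 0)
    (hF : ∀ Z : PrimeDivisor Y, HasOrder Z.1 F (A₁ Z - A₂ Z)) (hne : A₁ ≠ 0)
    (h₁ : ∀ Z ∈ A₁.support, IsPullback φ (Finsupp.single Z 1) (B Z))
    (h₂ : ∀ Z ∈ A₂.support, IsPullback φ (Finsupp.single Z 1) (B Z)) (R : PrimeDivisor X) :
    HasOrder R.1 (φ F) (∑ Z ∈ A₁.support, A₁ Z * B Z R - ∑ Z ∈ A₂.support, A₂ Z * B Z R) := by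
  classical
  have := R.2.2
  let S := A₁.support ∪ A₂.support
  have hS : ∀ Z ∈ S, IsPullback φ (Finsupp.single Z 1) (B Z) := by
    intro Z hZ
    rcases Finset.mem_union.1 hZ with h | h
    exacts [h₁ Z h, h₂ Z h]
  obtain ⟨Z₀, hZ₀⟩ := Finsupp.support_nonempty_iff.2 hne
  -- A component of A₁ is needed here: its pull-back supplies the image q of the generic point of R.
  obtain ⟨q, hq, hm, -⟩ := h₁ Z₀ hZ₀ R
  have hloc : ∀ Z ∈ S, ∃ g : RatFun, IsLocalEquation (Finsupp.single Z 1) q g ∧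
      HasOrder R.1 (φ g) (B Z R) := by
    intro Z hZ
    obtain ⟨q', hq', hm', hg⟩ := hS Z hZ R
    obtain rfl := hY.eq_of_mapsTo hq hq' hm hm'
    exact hg
  choose! g hg hgR using hloc
  have hsum : ∑ Z ∈ A₁.support, A₁ Z * B Z R - ∑ Z ∈ A₂.support, A₂ Z * B Z R =
      ∑ Z ∈ S, (A₁ Z - A₂ Z) * B Z R := by
    rw [Finset.sum_subset (show A₁.support ⊆ S from Finset.subset_union_left),
      Finset.sum_subset (show A₂.support ⊆ S from Finset.subset_union_right),
      ← Finset.sum_sub_distrib]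
    · exact Finset.sum_congr rfl fun Z _ => (sub_mul _ _ _).symm
    · intro Z _ hZ; rw [Finsupp.notMem_support_iff.1 hZ, zero_mul]
    · intro Z _ hZ; rw [Finsupp.notMem_support_iff.1 hZ, zero_mul]
  rw [hsum]
  -- Near q, F is compared with the product of the local equations of the components, whose
  -- pull-backs have known orders along R.
  refine hY.hasOrder_map (G := ∏ Z ∈ S, g Z ^ (A₁ Z - A₂ Z)) hq hm hF0 (fun W _ => hF W)
    (fun W hW => ?_) ?_
  · have := W.2.2
    have hW' : A₁ W - A₂ W =
        ∑ Z ∈ S, (A₁ Z - A₂ Z) * (Finsupp.single Z 1 : WeilDiv Y) W := by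
      by_cases hWS : W ∈ S
      · rw [Finset.sum_eq_single_of_mem W hWS, Finsupp.single_eq_same, mul_one]
        intro Z _ hZW
        rw [Finsupp.single_eq_of_ne' hZW, mul_zero]
      · rw [Finset.sum_eq_zero]
        · rw [Finset.mem_union, not_or, Finsupp.notMem_support_iff,
            Finsupp.notMem_support_iff] at hWS
          rw [hWS.1, hWS.2, sub_zero]
        · intro Z hZ
          rw [Finsupp.single_eq_of_ne', mul_zero]
          rintro rfl
          exact hWS hZ
    rw [hW']
    exact HasOrder.prod S fun Z hZ => ((hg Z hZ).2 W hW).zpow _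
  · rw [map_prod]
    refine HasOrder.prod S fun Z hZ => ?_
    rw [map_zpow₀]
    exact (hgR Z hZ).zpow _

/-! ### Orders of defining polynomials in the affine chart. -/

section DefiningPolynomials

/-- A polynomial as an element of the coordinate ring of the affine chart `(x, y)`. -/
abbrev polyCoord (p : MvPolynomial (Fin 2) ℂ) : coordRing xFun yFun := IsCoordPair.hom xFun yFun p

theorem isCoordPair_xy : IsCoordPair xFun yFun := isCoordPair_of_mem (by simp) (by simp)

theorem coe_polyCoord (p : MvPolynomial (Fin 2) ℂ) : (polyCoord p : RatFun) = polyFun p := by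
  rw [polyCoord, IsCoordPair.coe_hom]
  have h : MvPolynomial.aeval ![xFun, yFun] =
      IsScalarTower.toAlgHom ℂ (MvPolynomial (Fin 2) ℂ) RatFun := by
    apply MvPolynomial.algHom_ext
    intro i
    fin_cases i
    · simp [xFun, polyFun]
    · simp [yFun, polyFun]
  rw [h]
  rfl

theorem polyCoord_dvd_iff {p q : MvPolynomial (Fin 2) ℂ} : polyCoord p ∣ polyCoord q ↔ p ∣ q :=
  map_dvd_iff isCoordPair_xy.equiv

theorem isLocAtElement_polyCoord {Z : LocalSubring RatFun} (hZ : Z ∈ P1P1)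
    (hx : xFun ∈ Z.toSubring) (hy : yFun ∈ Z.toSubring) {p : MvPolynomial (Fin 2) ℂ}
    (hp : ∀ a, polyFun a ∈ vanishingSet Z ↔ p ∣ a) :
    IsLocAtElement (coordRing xFun yFun) (polyCoord p) Z := by
  have hloc := isLocAt_coordRing hZ (by simp) (by simp) hx hy
  refine ⟨hloc, fun b => ?_⟩
  obtain ⟨a, rfl⟩ := isCoordPair_xy.hom_bijective.2 b
  have h := hp a
  rw [mem_vanishingSet_iff, ← coe_polyCoord, and_iff_right (hloc.1 (polyCoord a).2)] at h
  rw [← not_iff_not, not_not, h]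
  exact polyCoord_dvd_iff.symm

theorem pushforward_single_one {X Y : Model} (W : PrimeDivisor X) :
    pushforward Y (Finsupp.single W 1) = pushforwardPrime Y W := by
  rw [pushforward, Finsupp.sum_single_index, one_smul]
  exact zero_smul ℤ _

theorem le_of_pushforwardPrime_eq_single {X Y : Model} {W : PrimeDivisor X} {Z : PrimeDivisor Y}
    (h : pushforwardPrime Y W = Finsupp.single Z 1) : Z.1 ≤ W.1 := by
  unfold pushforwardPrime at h
  split_ifs at h with hex
  · rw [← Finsupp.single_left_injective one_ne_zero h]
    exact hex.choose_spec
  · exact absurd h.symm (Finsupp.single_ne_zero.2 one_ne_zero)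

theorem pushforwardPrime_ne_zero {X Y : Model} {W : PrimeDivisor X} {Z : PrimeDivisor Y}
    (h : Z.1 ≤ W.1) : pushforwardPrime Y W ≠ 0 := by
  unfold pushforwardPrime
  rw [dif_pos ⟨Z, h⟩]
  exact Finsupp.single_ne_zero.2 one_ne_zero

open Classical in
/-- The order of a defining polynomial of the push-forward of `W` along a curve `V` that meets the
affine chart. -/
theorem IsDefiningPolynomial.hasOrder {X : Model} {W V : PrimeDivisor X}
    {p : MvPolynomial (Fin 2) ℂ}
    (hp : IsDefiningPolynomial (pushforward P1P1 (Finsupp.single W 1)) p)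
    {u : coordRing xFun yFun} (hu : Prime u) (hV : IsLocAtElement (coordRing xFun yFun) u V.1) :
    HasOrder V.1 (polyFun p) (if W = V then 1 else 0) := by
  have hdvr := V.2.2
  have hVP : V.1 ∈ P1P1 := mem_P1P1_iff.2 ⟨xFun, by simp, yFun, by simp, hV.1⟩
  have hxV : xFun ∈ V.1.toSubring := hV.1.1 (fst_mem_coordRing _ _)
  have hyV : yFun ∈ V.1.toSubring := hV.1.1 (snd_mem_coordRing _ _)
  have hone : HasOrder V.1 (polyFun 1) 0 := by
    rw [polyFun, map_one]; exact hasOrder_one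
  rw [pushforward_single_one] at hp
  rcases hp with ⟨h0, rfl⟩ | ⟨Z, hZ, h⟩
  · have hne : W ≠ V := by
      rintro rfl
      exact pushforwardPrime_ne_zero (Z := ⟨W.1, hVP, hdvr⟩) le_rfl h0
    rw [if_neg hne]
    exact hone
  have := Z.2.2
  have hZW : Z.1 = W.1 := eq_of_le_of_isDiscreteValuationRing
    (isRegularModel_P1P1.regular _ Z.2.1) (le_of_pushforwardPrime_eq_single hZ)
  rcases h with ⟨⟨hx, hy⟩, hirr, hpa⟩ | ⟨hn, rfl⟩
  · have hZp := isLocAtElement_polyCoord Z.2.1 hx hy hpa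
    by_cases hWV : W = V
    · rw [if_pos hWV]
      rw [hZW, hWV] at hZp
      rw [← coe_polyCoord]
      exact hasOrder_one_of_irreducible hZp.irreducible
    · rw [if_neg hWV, ← coe_polyCoord]
      -- Otherwise u and p are associated irreducibles and cut out the same curve, forcing W = V.
      have hnd : ¬ u ∣ polyCoord p := by
        intro hd
        have hirr' : Irreducible (polyCoord p) :=
          (MulEquiv.irreducible_iff isCoordPair_xy.equiv.toMulEquiv).2 hirr
        have hass := hu.irreducible.associated_of_dvd hirr' hd
        have hV' : IsLocAtElement (coordRing xFun yFun) (polyCoord p) V.1 :=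
          ⟨hV.1, fun b => by rw [hV.2 b, hass.dvd_iff_dvd_left]⟩
        exact hWV (Subtype.ext (hZW.symm.trans (hZp.unique hV')))
      have := (hV.2 _).2 hnd
      exact hasOrder_zero_iff.2 ⟨this.1, hV.1.1 (polyCoord p).2, this.2⟩
  · have hne : W ≠ V := by
      rintro rfl
      exact hn (by rw [hZW]; exact ⟨hxV, hyV⟩)
    rw [if_neg hne]
    exact hone

theorem hasOrder_factorProduct {X Y : Model} {A : WeilDiv Y} {B : PrimeDivisor Y → WeilDiv X}
    {p : PrimeDivisor Y → PrimeDivisor X → MvPolynomial (Fin 2) ℂ}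
    (hp : ∀ Z ∈ A.support, ∀ W ∈ (B Z).support,
      IsDefiningPolynomial (pushforward P1P1 (Finsupp.single W 1)) (p Z W))
    {V : PrimeDivisor X} {u : coordRing xFun yFun} (hu : Prime u)
    (hV : IsLocAtElement (coordRing xFun yFun) u V.1) :
    HasOrder V.1 (factorProduct A B p) (∑ Z ∈ A.support, A Z * B Z V) := by
  classical
  have := V.2.2
  refine HasOrder.prod _ fun Z hZ => HasOrder.zpow ?_ _
  have h : HasOrder V.1 ((B Z).prod fun W m => polyFun (p Z W) ^ m)
      (∑ W ∈ (B Z).support, B Z W * if W = V then 1 else 0) :=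
    HasOrder.prod _ fun W hW => ((hp Z hZ W hW).hasOrder hu hV).zpow _
  convert h using 1
  by_cases hVB : V ∈ (B Z).support
  · rw [Finset.sum_eq_single_of_mem V hVB, if_pos rfl, mul_one]
    intro W _ hW
    rw [if_neg hW, mul_zero]
  · rw [Finsupp.notMem_support_iff.1 hVB, Finset.sum_eq_zero]
    intro W hW
    rw [if_neg, mul_zero]
    rintro rfl
    exact hVB hW

/-- A rational function without zeros and poles in the affine chart is constant. -/
theorem exists_eq_algebraMap {f : RatFun} (hf : f ≠ 0)
    (h : ∀ u : coordRing xFun yFun, Prime u → ∀ V, IsLocAtElement (coordRing xFun yFun) u V →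
      HasOrder V f 0) : ∃ c : ℂ, c ≠ 0 ∧ f = algebraMap ℂ RatFun c := by
  have := isCoordPair_xy.isNoetherianRing
  have := isCoordPair_xy.uniqueFactorizationMonoid
  have h1 : f ∈ coordRing xFun yFun :=
    mem_of_forall_isLocAtElement (isCoordPair_xy.frac f) fun u hu V hV => by
      have := hV.isDiscreteValuationRing hu
      exact (hasOrder_zero_iff.1 (h u hu V hV)).2.1
  have h2 : f⁻¹ ∈ coordRing xFun yFun :=
    mem_of_forall_isLocAtElement (isCoordPair_xy.frac _) fun u hu V hV => by
      have := hV.isDiscreteValuationRing hu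
      exact (hasOrder_zero_iff.1 (h u hu V hV)).2.2
  have hunit : IsUnit (⟨f, h1⟩ : coordRing xFun yFun) := isUnit_subring_iff.2 ⟨hf, h2⟩
  obtain ⟨p, hp⟩ := isCoordPair_xy.equiv.surjective ⟨f, h1⟩
  rw [← hp, MulEquiv.isUnit_map, MvPolynomial.isUnit_iff_eq_C_of_isReduced] at hunit
  obtain ⟨c, hc, rfl⟩ := hunit
  refine ⟨c, hc.ne_zero, ?_⟩
  have hcf : f = (polyCoord (MvPolynomial.C c) : RatFun) := (congrArg Subtype.val hp).symm
  rw [hcf, coe_polyCoord]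
  rfl

end DefiningPolynomials

/-! ### Comparison of orders and conclusion. -/

theorem map_linForm (φ : RatFun →ₐ[ℂ] RatFun) (a : OnePoint ℂ) (c : RatFun) :
    φ (linForm a c) = linForm a (φ c) := by
  induction a using OnePoint.rec with
  | infty => exact map_one φ
  | coe b => rw [linForm_coe, linForm_coe, map_sub, AlgHom.commutes]

theorem IsCoordinateLine.hasOrder_div {c d : RatFun} (h : IsCoordSystem c d)
    (h' : IsCoordSystem c⁻¹ d) (hc : ∀ Z ∈ P1P1, c ∈ Z.toSubring ∨ c⁻¹ ∈ Z.toSubring)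
    {a₁ a₂ : OnePoint ℂ} {D₁ D₂ : WeilDiv P1P1} (h₁ : IsCoordinateLine c a₁ D₁)
    (h₂ : IsCoordinateLine c a₂ D₂) (Z : PrimeDivisor P1P1) :
    HasOrder Z.1 (linForm a₁ c / linForm a₂ c) (D₁ Z - D₂ Z) := by
  have := Z.2.2
  obtain ⟨s, hs⟩ := exists_hasOrder_linForm h h' hc Z
  obtain ⟨W₁, hW₁, rfl⟩ := h₁
  obtain ⟨W₂, hW₂, rfl⟩ := h₂
  convert (hs a₁ W₁ hW₁).div (hs a₂ W₂ hW₂) using 1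
  ring

/-- The line is itself a curve on the blown-up surface and has coefficient 1 there. This provides
the component needed in `hasOrder_map_of_isPullback`. -/
theorem IsCoordinateLine.pullback_ne_zero {X : Model} (hX : IsBlownUpSurface X) {c : RatFun}
    {a : OnePoint ℂ} {D : WeilDiv P1P1} {A : WeilDiv X} (hD : IsCoordinateLine c a D)
    (hA : IsPullback (AlgHom.id ℂ RatFun) D A) : A ≠ 0 := by
  obtain ⟨W, -, rfl⟩ := hD
  have := W.2.2
  rintro rfl
  obtain ⟨q, -, hm, g, hg, ho⟩ := hA ⟨W.1, hX.mem_of_mem_P1P1 W.2.1, W.2.2⟩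
  have h1 := hg.2 W fun a ha => hm.mem ha
  rw [Finsupp.single_eq_same] at h1
  exact absurd (h1.unique ho) one_ne_zero

/-- The factorization of the pull-back of a coordinate. -/
theorem exists_linForm_div_eq {X Y : Model} (hX : IsBlownUpSurface X) (hY : IsBlownUpSurface Y)
    (φ : RatFun →ₐ[ℂ] RatFun) {c d : RatFun} (h : IsCoordSystem c d) (h' : IsCoordSystem c⁻¹ d)
    (hc : ∀ Z ∈ P1P1, c ∈ Z.toSubring ∨ c⁻¹ ∈ Z.toSubring)
    {a₁ a₂ : OnePoint ℂ} {D₁ D₂ : WeilDiv P1P1} (hD₁ : IsCoordinateLine c a₁ D₁)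
    (hD₂ : IsCoordinateLine c a₂ D₂) {A₁ A₂ : WeilDiv Y}
    (hA₁ : IsPullback (AlgHom.id ℂ RatFun) D₁ A₁) (hA₂ : IsPullback (AlgHom.id ℂ RatFun) D₂ A₂)
    {B : PrimeDivisor Y → WeilDiv X}
    (hB₁ : ∀ Z ∈ A₁.support, IsPullback φ (Finsupp.single Z 1) (B Z))
    (hB₂ : ∀ Z ∈ A₂.support, IsPullback φ (Finsupp.single Z 1) (B Z))
    {p₁ p₂ : PrimeDivisor Y → PrimeDivisor X → MvPolynomial (Fin 2) ℂ}
    (hp₁ : ∀ Z ∈ A₁.support, ∀ W ∈ (B Z).support,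
      IsDefiningPolynomial (pushforward P1P1 (Finsupp.single W 1)) (p₁ Z W))
    (hp₂ : ∀ Z ∈ A₂.support, ∀ W ∈ (B Z).support,
      IsDefiningPolynomial (pushforward P1P1 (Finsupp.single W 1)) (p₂ Z W)) :
    ∃ C : ℂ, C ≠ 0 ∧ linForm a₁ (φ c) / linForm a₂ (φ c) =
      algebraMap ℂ RatFun C * (factorProduct A₁ B p₁ / factorProduct A₂ B p₂) := by
  have hYr := hY.isRegularModel
  have := isCoordPair_xy.isNoetherianRing
  have hord := IsCoordinateLine.hasOrder_div h h' hc hD₁ hD₂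
  have hF0 : linForm a₁ c / linForm a₂ c ≠ 0 := by
    obtain ⟨W, -, -⟩ := hD₁
    exact (hord W).ne_zero
  have hordY := hasOrder_of_isPullback_id isRegularModel_P1P1 hF0 hord hA₁ hA₂
  have hne := hD₁.pullback_ne_zero hY hA₁
  have key : ∀ u : coordRing xFun yFun, Prime u → ∀ V,
      IsLocAtElement (coordRing xFun yFun) u V →
      factorProduct A₁ B p₁ / factorProduct A₂ B p₂ ≠ 0 ∧
      HasOrder V (φ (linForm a₁ c / linForm a₂ c) /
        (factorProduct A₁ B p₁ / factorProduct A₂ B p₂)) 0 := by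
    intro u hu V hV
    have hdvr := hV.isDiscreteValuationRing hu
    have hVX : V ∈ X := hX.mem_of_mem_P1P1
      (mem_P1P1_iff.2 ⟨xFun, by simp, yFun, by simp, hV.1⟩)
    have h1 := hasOrder_map_of_isPullback hYr hF0 hordY hne hB₁ hB₂ ⟨V, hVX, hdvr⟩
    have h2 := hasOrder_factorProduct (V := ⟨V, hVX, hdvr⟩) hp₁ hu hV
    have h3 := hasOrder_factorProduct (V := ⟨V, hVX, hdvr⟩) hp₂ hu hV
    have h4 := HasOrder.div (R := V) h2 h3
    refine ⟨h4.ne_zero, ?_⟩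
    simpa using HasOrder.div (R := V) h1 h4
  have hG0 : factorProduct A₁ B p₁ / factorProduct A₂ B p₂ ≠ 0 := by
    -- Having an order along a single curve, here x = 0, already shows that the quotient is nonzero.
    obtain ⟨V, hV⟩ := exists_isLocAtElement (isCoordPair_xy.prime_line 0)
    exact (key _ (isCoordPair_xy.prime_line 0) V hV).1
  obtain ⟨C, hC, hCf⟩ := exists_eq_algebraMap
    (div_ne_zero ((map_ne_zero φ).2 hF0) hG0) fun u hu V hV => (key u hu V hV).2
  refine ⟨C, hC, ?_⟩
  rw [← hCf, div_mul_cancel₀ _ hG0, map_div₀, map_linForm, map_linForm]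

end BlowupFactorization

end

theorem mainTheorem2
    -- the blown-up surfaces and the comorphism of the dominant rational map and of its lift
    (X Xbar : Model) (hX : IsBlownUpSurface X) (hXbar : IsBlownUpSurface Xbar)
    (φ : RatFun →ₐ[ℂ] RatFun)
    (x₁ x₂ y₁ y₂ : OnePoint ℂ) (hx : x₁ ≠ x₂) (hy : y₁ ≠ y₂)
    -- the four coordinate lines on the target
    (D : Fin 4 → WeilDiv P1P1)
    (hD₁ : IsCoordinateLine xFun x₁ (D 0)) (hD₂ : IsCoordinateLine xFun x₂ (D 1))
    (hD₃ : IsCoordinateLine yFun y₁ (D 2)) (hD₄ : IsCoordinateLine yFun y₂ (D 3))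
    -- their pull-backs to the blown-up target surface
    (A : Fin 4 → WeilDiv Xbar) (hA : ∀ i, IsPullback (AlgHom.id ℂ RatFun) (D i) (A i))
    -- the pull-backs of the components under the lifted map
    (B : PrimeDivisor Xbar → WeilDiv X)
    (hB : ∀ i, ∀ Z ∈ (A i).support, IsPullback φ (Finsupp.single Z 1) (B Z))
    -- irreducible defining polynomials of the push-forwards of their components
    (p : Fin 4 → PrimeDivisor Xbar → PrimeDivisor X → MvPolynomial (Fin 2) ℂ)
    (hp : ∀ i, ∀ Z ∈ (A i).support, ∀ W ∈ (B Z).support,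
      IsDefiningPolynomial (pushforward P1P1 (Finsupp.single W 1)) (p i Z W)) :
    (∃ C₁ : ℂ, C₁ ≠ 0 ∧
      linForm x₁ (φ xFun) / linForm x₂ (φ xFun) =
        algebraMap ℂ RatFun C₁ * (factorProduct (A 0) B (p 0) / factorProduct (A 1) B (p 1))) ∧
    (∃ C₂ : ℂ, C₂ ≠ 0 ∧
      linForm y₁ (φ yFun) / linForm y₂ (φ yFun) =
        algebraMap ℂ RatFun C₂ * (factorProduct (A 2) B (p 2) / factorProduct (A 3) B (p 3))) := by
  have hx' := fun Z hZ => (coordinate_mem (Z := Z) hZ).1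
  have hy' := fun Z hZ => (coordinate_mem (Z := Z) hZ).2
  exact ⟨exists_linForm_div_eq hX hXbar φ (isCoordSystem_x (by simp)) (isCoordSystem_x (by simp)) hx'
      hD₁ hD₂ (hA 0) (hA 1) (hB 0) (hB 1) (hp 0) (hp 1),
    exists_linForm_div_eq hX hXbar φ (isCoordSystem_y (by simp)) (isCoordSystem_y (by simp)) hy'
      hD₃ hD₄ (hA 2) (hA 3) (hB 2) (hB 3) (hp 2) (hp 3)⟩
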